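/- **Model.** A network is a finite connected simple graph with anonymous nodes; each node gives locally distinct (otherwise arbitrary) labels to its incident links and carries a whiteboard. There are $k$ mobile agents with distinct identifiers in $\mathbb{N}$. A (deterministic) algorithm consists of a nonempty countable set of agent states, a nonempty countable set of whiteboard contents, and a transition function: from the identifier and state of the acting agent, the link labels of its node, the label of the link by which it arrived, the content of the node's whiteboard, and the identifiers and states of the other agents at the node, it determines the new state, the new whiteboard content, and whether the agent stays or through which link it migrates. The algorithm does not depend on the network or on $k$. *Asynchrony:* at each step an arbitrary set of agents, at most one per node, act concurrently; the only fairness assumption is that each agent acts infinitely often. *Half-duplex links:* two agents never cross the same link in opposite directions in the same step. *Control whiteboards:* each agent has a piece of gossip information, which cannot be stored on whiteboards; agents located at the same node give each other all the gossip information they have collected. An execution starts from an arbitrary configuration (locations, states, whiteboards), where each agent holds at least its own gossip information. An algorithm is a *self-stabilizing solution to the gossip problem* if for every $k$, every network and all distinct identifiers, in every execution every agent eventually knows the gossip information of all $k$ agents. It is *$l$-quiescent for $k$ agents* if every execution with $k$ agents, in any network, reaches a configuration after which at least $l$ agents remain still forever. The *quiescence number* of the $k$-gossip problem is the maximum integer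 $l\ge 0$ such that some self-stabilizing solution is $l$-quiescent for $k$ agents, or $-1$ if there is no such $l$. **Theorem.** In this model (asynchronous, half-duplex links, control whiteboards, named agents), the quiescence number of the $k$-gossip problem is $0$ for every $k\ge 1$. Moreover, there is a self-stabilizing solution to the gossip problem such that in every execution every agent is infinitely often at the same node as the agent with the minimum identifier. -/

import Mathlib

namespace MobileAgents

/-- An anonymous network: a connected simple graph (finite in all uses below) in which every node
gives locally distinct, otherwise arbitrary, natural-number labels to its incident links.
`label v w` is the label at `v` of the link from `v` to its neighbour `w`; the values of `label v`
outside the neighbourhood of `v` play no role. -/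
structure Network (V : Type) where
  graph : SimpleGraph V
  connected : graph.Connected
  label : V → V → ℕ
  label_inj : ∀ v w w', graph.Adj v w → graph.Adj v w' → label v w = label v w' → w = w'

section Network

variable {V : Type}

/-- The set of labels of the links incident to `v`. -/
noncomputable def Network.ports [Finite V] (N : Network V) (v : V) : Finset ℕ :=
  (Set.toFinite (N.label v '' {w | N.graph.Adj v w})).toFinset

open Classical in
/-- The node reached from `v` on the order `o`: `some p` means "migrate through the link labelled
`p`", `none` means "stay". An order naming a nonexistent label has no effect. -/
noncomputable def Network.dest (N : Network V) (v : V) (o : Option ℕ) : V :=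
  if h : ∃ w, N.graph.Adj v w ∧ o = some (N.label v w) then h.choose else v

open Classical in
/-- The incoming-link label held by an agent which acted at `v` with order `o`, where `old` is the
one it held before: if the agent migrates, it is the label, at the node of arrival, of the link just
used; if it stays, nothing changes. -/
noncomputable def Network.inLabel (N : Network V) (v : V) (o : Option ℕ) (old : Option ℕ) :
    Option ℕ :=
  if N.dest v o = v then old else some (N.label (N.dest v o) v)

end Network

/-- A (deterministic, uniform) algorithm for named agents with natural-number identifiers.
`State` is the set of control states of an agent and `Board` the set of possible (control) contents
of a whiteboard; both are countable, i.e. every state and every content has a finite description,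
and neither contains gossip information. `act` is the transition function: from the identifier and
the state of the acting agent, the link labels of its node, the label of the link by which it came,
the content of the whiteboard, and the identifiers and states of the other agents at its node, it
computes the new state, the new content of the whiteboard and the migration order. Nothing in an
algorithm depends on the network or on the number of agents. -/
structure Algorithm where
  State : Type
  Board : Type
  state_nonempty : Nonempty State
  board_nonempty : Nonempty Board
  state_countable : Countable State
  board_countable : Countable Board
  act : (id : ℕ) → (state : State) → (ports : Finset ℕ) → (inPort : Option ℕ) → (board : Board) →
    (others : Finset (ℕ × State)) → State × Board × Option ℕ

/-- A configuration of `k` agents on the node set `V`. `know a` is the set of the agents whose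
gossip information is held by `a`. Since whiteboards hold control information only, they hold no
gossip information. -/
structure Config (A : Algorithm) (k : ℕ) (V : Type) where
  pos : Fin k → V
  inPort : Fin k → Option ℕ
  state : Fin k → A.State
  board : V → A.Board
  know : Fin k → Set (Fin k)

section Dynamics

variable {A : Algorithm} {k : ℕ} {V : Type}

/-- The identifiers and states of the agents other than `a` at the node of `a`. -/
noncomputable def Config.others (c : Config A k V) (ids : Fin k ↪ ℕ) (a : Fin k) :
    Finset (ℕ × A.State) :=
  (Set.toFinite ((fun b => (ids b, c.state b)) '' {b | b ≠ a ∧ c.pos b = c.pos a})).toFinset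

/-- The result of the transition function for agent `a` in configuration `c`. -/
noncomputable def Config.action [Finite V] (c : Config A k V) (N : Network V) (ids : Fin k ↪ ℕ)
    (a : Fin k) : A.State × A.Board × Option ℕ :=
  A.act (ids a) (c.state a) (N.ports (c.pos a)) (c.inPort a) (c.board (c.pos a)) (c.others ids a)

/-- The node where agent `a` is after executing its action in configuration `c`. -/
noncomputable def Config.target [Finite V] (c : Config A k V) (N : Network V) (ids : Fin k ↪ ℕ)
    (a : Fin k) : V :=
  N.dest (c.pos a) (c.action N ids a).2.2

/-- One step of the asynchronous system with half-duplex links and control whiteboards, from `c`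
to `c'`: the agents of `S` execute their actions concurrently. -/
structure Step [Finite V] (N : Network V) (ids : Fin k ↪ ℕ) (S : Set (Fin k))
    (c c' : Config A k V) : Prop where
  /-- Agents at the same node act sequentially. -/
  sequential : ∀ a ∈ S, ∀ b ∈ S, c.pos a = c.pos b → a = b
  /-- Half-duplex links: no two agents cross the same link in opposite directions at the same time
  (of two agents which would, at most one is allowed to act). -/
  halfDuplex : ∀ a ∈ S, ∀ b ∈ S, c.target N ids a = c.pos b → c.target N ids b = c.pos a → a = b
  /-- The agents of `S` execute their actions. -/
  pos_active : ∀ a ∈ S, c'.pos a = c.target N ids a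
  inPort_active : ∀ a ∈ S, c'.inPort a = N.inLabel (c.pos a) (c.action N ids a).2.2 (c.inPort a)
  state_active : ∀ a ∈ S, c'.state a = (c.action N ids a).1
  board_active : ∀ a ∈ S, c'.board (c.pos a) = (c.action N ids a).2.1
  /-- Nothing else changes. -/
  pos_idle : ∀ a ∉ S, c'.pos a = c.pos a
  inPort_idle : ∀ a ∉ S, c'.inPort a = c.inPort a
  state_idle : ∀ a ∉ S, c'.state a = c.state a
  board_idle : ∀ v, (∀ a ∈ S, c.pos a ≠ v) → c'.board v = c.board v
  /-- Agents that meet at a node transfer all the collected gossip information to each other. -/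
  exchange : ∀ a, c'.know a = {g | ∃ b, c.pos b = c.pos a ∧ g ∈ c.know b}

/-- An execution of algorithm `A` by `k` agents with identifiers `ids` in the network `N`: it
starts from an arbitrary configuration (locations, states, incoming-link labels, whiteboards; an
agent holds at least its own gossip information), and the asynchronous scheduler allows each agent
to act infinitely often. -/
structure Execution (A : Algorithm) {k : ℕ} {V : Type} [Finite V] (N : Network V)
    (ids : Fin k ↪ ℕ) where
  conf : ℕ → Config A k V
  active : ℕ → Set (Fin k)
  init : ∀ a, a ∈ (conf 0).know a
  step : ∀ t, Step N ids (active t) (conf t) (conf (t + 1))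
  fair : ∀ a t, ∃ s, t ≤ s ∧ a ∈ active s

end Dynamics

/-- `A` is a self-stabilizing solution to the gossip problem: for every number of agents (which is
unknown to them), every network and all distinct identifiers, in every execution, from any initial
configuration, eventually every agent knows the gossip information of all the agents. -/
def Algorithm.SolvesGossip (A : Algorithm) : Prop :=
  ∀ (k : ℕ) (V : Type) [Finite V] (N : Network V) (ids : Fin k ↪ ℕ) (e : Execution A N ids),
    ∃ T, ∀ t, T ≤ t → ∀ a b : Fin k, b ∈ (e.conf t).know a

/-- `A` is `l`-quiescent for `k` agents: every execution with `k` agents, in any network, reaches a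
configuration after which `l` or more agents remain still forever. -/
def Algorithm.IsQuiescent (A : Algorithm) (k l : ℕ) : Prop :=
  ∀ (V : Type) [Finite V] (N : Network V) (ids : Fin k ↪ ℕ) (e : Execution A N ids),
    ∃ T, ∃ Q : Finset (Fin k), l ≤ Q.card ∧
      ∀ a ∈ Q, ∀ t, T ≤ t → (e.conf t).pos a = (e.conf T).pos a

/-- `q` is the quiescence number of the `k`-gossip problem among named agents in the asynchronous
model with control whiteboards and half-duplex links: the maximum `l` such that an `l`-quiescent
self-stabilizing solution exists, or `-1` if there is no `0`-quiescent one. -/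
def IsGossipQuiescenceNumber (k : ℕ) (q : ℤ) : Prop :=
  IsGreatest
    (insert (-1) {z : ℤ | ∃ l : ℕ, z = l ∧ ∃ A : Algorithm, A.SolvesGossip ∧ A.IsQuiescent k l}) q

/-- In every execution of `A`, every agent meets the agent with the minimum identifier (is at the
same node) infinitely often. -/
def Algorithm.MeetsMinInfinitelyOften (A : Algorithm) : Prop :=
  ∀ (k : ℕ) (V : Type) [Finite V] (N : Network V) (ids : Fin k ↪ ℕ) (e : Execution A N ids)
    (p : Fin k), (∀ b, ids p ≤ ids b) →
      ∀ a T, ∃ t, T ≤ t ∧ (e.conf t).pos a = (e.conf t).pos p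

end MobileAgents

/-! Upper bound. Suppose a solution is `l`-quiescent for `k` agents with `l ≥ 1`. On the network
with two nodes, if every agent could be made to move from every configuration, some fair execution
would let nobody rest (`exists_execution_moving`). So some agent cannot be driven out of its node,
and a minimal group around it stays there although all its members act fairly: a `Stall`
(`exists_move_of_no_stall`). A stalled group only sees a node with the single port `0`, so it
behaves identically at a leaf of any larger network. Two stalls with disjoint identifier sets,
planted at the two ends of a four-node path, never exchange gossip (`not_solvesGossip_of_stall`).
The number of agents on the path need not be `k`; this is where uniformity of the algorithm is used.

Lower bound. The agent `P` with the minimum identifier eventually roams along a universal word of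
link labels, leaving at each node the time stamp and link of its last departure; the others follow
this trail. Signs of nonexistent smaller identifiers and stale stamps are harmless: following a sign
raises a bound, and only larger stamps count afterwards (`Execution.eventually_not_sees`,
`Trailing.exists_pursuit`).

What remains is a pursuit on a graph. The universal word makes `P` sweep a fixed spanning tree
arbitrarily often in succession. After one sweep all pointers lie in the tree and lead toward `P`. A
pursuer that is an ancestor of `P` stays between `P` and the root, so it is met by the end of the
sweep, when `P` is at the root; half-duplex links prevent the two from crossing. A pursuer that is
never an ancestor only climbs, and loses depth in each sweep (`Pursuit.depth_lt`). Depth being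
bounded, a meeting occurs. Infinitely many meetings with `P` spread all gossip. -/

namespace MobileAgents

/-! ### Migration along labelled links -/

section Dest

variable {V : Type} (N : Network V)

theorem Network.dest_label {v w : V} (h : N.graph.Adj v w) :
    N.dest v (some (N.label v w)) = w := by
  have hex : ∃ w', N.graph.Adj v w' ∧ some (N.label v w) = some (N.label v w') := ⟨w, h, rfl⟩
  rw [Network.dest, dif_pos hex]
  obtain ⟨h1, h2⟩ := hex.choose_spec
  exact (N.label_inj v _ _ h h1 (Option.some_injective _ h2)).symm

theorem Network.dest_eq_self {v : V} {o : Option ℕ}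
    (h : ¬ ∃ w, N.graph.Adj v w ∧ o = some (N.label v w)) : N.dest v o = v := by
  rw [Network.dest, dif_neg h]

theorem Network.mem_ports [Finite V] {v : V} {p : ℕ} :
    p ∈ N.ports v ↔ ∃ w, N.graph.Adj v w ∧ N.label v w = p := by
  simp [Network.ports]

theorem Network.dest_eq_self_iff [Finite V] {v : V} {p : ℕ} :
    N.dest v (some p) = v ↔ p ∉ N.ports v := by
  rw [N.mem_ports]
  constructor
  · rintro h ⟨w, hw, rfl⟩
    rw [N.dest_label hw] at h
    exact hw.ne h.symm
  · intro h
    refine N.dest_eq_self ?_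
    rintro ⟨w, hw, h'⟩
    exact h ⟨w, hw, (Option.some_injective _ h').symm⟩

theorem Network.dest_none {v : V} : N.dest v none = v :=
  N.dest_eq_self (by simp)

end Dest

/-- Every value of a countable type can be listed infinitely often. -/
theorem exists_seq_frequently (ι : Type*) [Nonempty ι] [Countable ι] :
    ∃ g : ℕ → ι, ∀ i n, ∃ m, n ≤ m ∧ g m = i := by
  obtain ⟨f, hf⟩ := exists_surjective_nat ι
  refine ⟨fun n => f n.unpair.1, fun i n => ?_⟩
  obtain ⟨j, rfl⟩ := hf i
  exact ⟨Nat.pair j n, Nat.right_le_pair j n, by simp⟩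

/-! ### Stalled groups and the impossibility of gossip -/

/-- The identifiers and states of the agents with identifiers in `S` other than `i`. -/
noncomputable def companions {α : Type} (S : Finset ℕ) (st : ℕ → α) (i : ℕ) : Finset (ℕ × α) :=
  (Set.toFinite ((fun j => (j, st j)) '' {j | j ∈ S ∧ j ≠ i})).toFinset

/-- A fair sequential activity of the agents with identifiers in `S` at one node whose only link is
labelled `0`, during which no agent leaves the node. -/
structure Stall (A : Algorithm) (S : Finset ℕ) where
  inPort : ℕ → Option ℕ
  actor : ℕ → ℕ
  state : ℕ → ℕ → A.State
  board : ℕ → A.Board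
  actor_mem : ∀ t, actor t ∈ S
  fair : ∀ i ∈ S, ∀ t, ∃ s, t ≤ s ∧ actor s = i
  result : ℕ → A.State × A.Board × Option ℕ
  result_eq : ∀ t, result t = A.act (actor t) (state t (actor t)) {0} (inPort (actor t)) (board t)
    (companions S (state t) (actor t))
  stay : ∀ t, (result t).2.2 ≠ some 0
  state_actor : ∀ t, state (t + 1) (actor t) = (result t).1
  state_other : ∀ t, ∀ j ∈ S, j ≠ actor t → state (t + 1) j = state t j
  board_succ : ∀ t, board (t + 1) = (result t).2.1

/-- The path with four nodes `(true, false)`, `(true, true)`, `(false, true)`, `(false, false)`,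
whose two leaves label their links by `0`. -/
def fourPath : Network (Bool × Bool) where
  graph :=
    { Adj := fun v w => v ≠ w ∧ (v.1 = w.1 ∨ (v.2 = true ∧ w.2 = true))
      symm := ⟨by decide⟩
      loopless := ⟨by decide⟩ }
  connected := by
    have key : ∀ G : SimpleGraph (Bool × Bool),
        (∀ v w, v ≠ w ∧ (v.1 = w.1 ∨ (v.2 = true ∧ w.2 = true)) → G.Adj v w) → G.Connected := by
      intro G h
      have h1 : ∀ v, G.Reachable v (true, true) := by
        have e1 : G.Reachable (false, true) (true, true) := (h _ _ (by decide)).reachable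
        have e2 : G.Reachable (false, false) (false, true) := (h _ _ (by decide)).reachable
        have e3 : G.Reachable (true, false) (true, true) := (h _ _ (by decide)).reachable
        rintro ⟨_ | _, _ | _⟩
        · exact e2.trans e1
        · exact e1
        · exact e3
        · exact SimpleGraph.Reachable.refl _
      exact ⟨fun v w => (h1 v).trans (h1 w).symm⟩
    exact key _ fun v w h => h
  label v w := if v.1 = w.1 then 0 else 1
  label_inj := by decide

theorem fourPath_ports_leaf (b : Bool) : fourPath.ports (b, false) = {0} := by
  ext p
  rw [Network.mem_ports, Finset.mem_singleton]
  constructor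
  · rintro ⟨⟨c, d⟩, h, rfl⟩
    revert h
    simp only [fourPath]
    cases b <;> cases c <;> cases d <;> simp
  · rintro rfl
    exact ⟨(b, true), by simp [fourPath], by simp [fourPath]⟩

/-- Both stalls run in parallel, one at each leaf of `fourPath`. Since the leaves have port set
`{0}` and nobody leaves, each agent's local view is exactly the one recorded in its stall. -/
theorem not_solvesGossip_of_stall {A : Algorithm} {S : Bool → Finset ℕ} (σ : ∀ b, Stall A (S b))
    (hne : ∀ b, (S b).Nonempty) (hdisj : Disjoint (S true) (S false)) : ¬ A.SolvesGossip := by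
  classical
  intro hA
  set U := S true ∪ S false with hU
  let ids : Fin U.card ↪ ℕ := (U.orderEmbOfFin rfl).toEmbedding
  have hids : ∀ a, ids a ∈ U := fun a => U.orderEmbOfFin_mem rfl a
  have hsurj : ∀ i ∈ U, ∃ a, ids a = i := by
    intro i hi
    have : i ∈ Set.range (U.orderEmbOfFin rfl) := by rw [Finset.range_orderEmbOfFin]; exact hi
    exact this
  let side : Fin U.card → Bool := fun a => decide (ids a ∈ S true)
  have hside : ∀ a b, side a = b ↔ ids a ∈ S b := by
    intro a b
    have h1 : ids a ∈ S true ∪ S false := hids a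
    rw [Finset.mem_union] at h1
    have h2 : ids a ∈ S true → ids a ∉ S false := fun h => Finset.disjoint_left.1 hdisj h
    cases b
    · simp only [side, decide_eq_false_iff_not]
      tauto
    · simp only [side, decide_eq_true_eq]
  have hmem : ∀ b, ∀ i ∈ S b, i ∈ U := by
    intro b i hi
    rw [hU, Finset.mem_union]
    cases b <;> tauto
  obtain ⟨b0⟩ := A.board_nonempty
  let conf : ℕ → Config A U.card (Bool × Bool) := fun t =>
    { pos := fun a => (side a, false)
      inPort := fun a => (σ (side a)).inPort (ids a)
      state := fun a => (σ (side a)).state t (ids a)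
      board := fun v => if v.2 then b0 else (σ v.1).board t
      -- Each agent starts with all the gossip of its own side; this set is invariant under
      -- exchange, since only agents of one side share a node.
      know := fun a => {g | side g = side a} }
  let active : ℕ → Set (Fin U.card) := fun t => {a | ids a = (σ (side a)).actor t}
  have hact : ∀ t, ∀ a ∈ active t, (conf t).action fourPath ids a = (σ (side a)).result t := by
    intro t a ha
    have ha' : ids a = (σ (side a)).actor t := ha
    have hoth : (conf t).others ids a =
        companions (S (side a)) ((σ (side a)).state t) ((σ (side a)).actor t) := by
      ext ⟨i, s⟩
      simp only [Config.others, companions, Set.Finite.mem_toFinset, Set.mem_image,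
        Set.mem_ofPred_eq, conf]
      constructor
      · rintro ⟨b, ⟨hb, hp⟩, h⟩
        have hs : side b = side a := (Prod.ext_iff.1 hp).1
        refine ⟨ids b, ⟨(hside b _).1 hs, fun h' => hb (ids.injective (h'.trans ha'.symm))⟩, ?_⟩
        rw [← h, hs]
      · rintro ⟨j, ⟨hj, hne⟩, h⟩
        obtain ⟨b, rfl⟩ := hsurj j (hmem _ _ hj)
        have hs : side b = side a := (hside b _).2 hj
        refine ⟨b, ⟨fun h' => hne (h' ▸ ha'), by rw [hs]⟩, ?_⟩
        rw [← h, hs]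
    rw [(σ (side a)).result_eq t, Config.action, hoth]
    simp only [conf, fourPath_ports_leaf, ha']
    rfl
  have hdest : ∀ t, ∀ a ∈ active t,
      fourPath.dest ((conf t).pos a) ((conf t).action fourPath ids a).2.2 = (conf t).pos a := by
    intro t a ha
    rw [hact t a ha]
    have h := (σ (side a)).stay t
    rcases ho : ((σ (side a)).result t).2.2 with _ | p
    · exact fourPath.dest_none
    · rw [fourPath.dest_eq_self_iff]
      change p ∉ fourPath.ports (side a, false)
      rw [fourPath_ports_leaf, Finset.mem_singleton]
      rintro rfl
      exact h ho
  have hseq : ∀ t, ∀ a ∈ active t, ∀ b ∈ active t, (conf t).pos a = (conf t).pos b → a = b := by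
    intro t a ha b hb h
    have hs : side a = side b := (Prod.ext_iff.1 h).1
    have ha' : ids a = (σ (side a)).actor t := ha
    have hb' : ids b = (σ (side b)).actor t := hb
    rw [hs] at ha'
    exact ids.injective (ha'.trans hb'.symm)
  have hstep : ∀ t, Step fourPath ids (active t) (conf t) (conf (t + 1)) := by
    intro t
    refine ⟨hseq t, ?_, ?_, ?_, ?_, ?_, fun _ _ => rfl, fun _ _ => rfl, ?_, ?_, ?_⟩
    · intro a ha b hb h1 _
      refine hseq t a ha b hb ?_
      rw [← h1]
      exact (hdest t a ha).symm
    · intro a ha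
      exact (hdest t a ha).symm
    · intro a ha
      rw [Network.inLabel, if_pos (hdest t a ha)]
    · intro a ha
      rw [hact t a ha, ← (σ (side a)).state_actor t]
      exact congrArg _ ha
    · intro a ha
      rw [hact t a ha, ← (σ (side a)).board_succ t]
      rfl
    · intro a ha
      exact (σ (side a)).state_other t _ ((hside a _).1 rfl) ha
    · intro v hv
      rcases v with ⟨s, _ | _⟩
      · obtain ⟨a, h⟩ := hsurj _ (hmem _ _ ((σ s).actor_mem t))
        have hs : side a = s := (hside a s).2 (h ▸ (σ s).actor_mem t)
        refine absurd ?_ (hv a ?_)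
        · simp only [conf, hs]
        · change ids a = (σ (side a)).actor t
          rw [hs, h]
      · rfl
    · intro a
      ext g
      constructor
      · intro h
        exact ⟨a, rfl, h⟩
      · rintro ⟨b, hb, h⟩
        exact Eq.trans h (Prod.ext_iff.1 hb).1
  let e : Execution A fourPath ids :=
    { conf := conf
      active := active
      init := fun a => rfl
      step := hstep
      fair := by
        intro a t
        obtain ⟨s, hs, h⟩ := (σ (side a)).fair (ids a) ((hside a _).1 rfl) t
        exact ⟨s, hs, h.symm⟩ }
  obtain ⟨T, hT⟩ := hA U.card (Bool × Bool) fourPath ids e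
  obtain ⟨i, hi⟩ := hne true
  obtain ⟨j, hj⟩ := hne false
  obtain ⟨a, rfl⟩ := hsurj i (hmem _ _ hi)
  obtain ⟨b, rfl⟩ := hsurj j (hmem _ _ hj)
  have h : side b = side a := hT T le_rfl a b
  rw [(hside a _).2 hi, (hside b _).2 hj] at h
  exact absurd h (by simp)

/-- The network with two nodes, joined by a link labelled `0` at both ends. -/
def twoPath : Network Bool where
  graph := ⊤
  connected := SimpleGraph.connected_top
  label _ _ := 0
  label_inj := by decide

theorem twoPath_ports (b : Bool) : twoPath.ports b = {0} := by
  ext p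
  rw [Network.mem_ports, Finset.mem_singleton]
  constructor
  · rintro ⟨_, _, rfl⟩
    rfl
  · rintro rfl
    exact ⟨!b, by cases b <;> simp [twoPath], rfl⟩

/-! ### Schedules in which agents act one at a time -/

section SingleSteps

variable {A : Algorithm} {k : ℕ} {V : Type} [Finite V] (N : Network V) (ids : Fin k ↪ ℕ)

open Classical in
/-- The configuration reached from `c` when the agent `a` acts alone. -/
noncomputable def Config.next (c : Config A k V) (a : Fin k) : Config A k V where
  pos := Function.update c.pos a (c.target N ids a)
  inPort := Function.update c.inPort a
    (N.inLabel (c.pos a) (c.action N ids a).2.2 (c.inPort a))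
  state := Function.update c.state a (c.action N ids a).1
  board := Function.update c.board (c.pos a) (c.action N ids a).2.1
  know := fun a => {g | ∃ b, c.pos b = c.pos a ∧ g ∈ c.know b}

theorem Config.step_next (c : Config A k V) (a : Fin k) : Step N ids {a} c (c.next N ids a) where
  sequential := by rintro _ rfl _ rfl _; rfl
  halfDuplex := by rintro _ rfl _ rfl _ _; rfl
  pos_active := by rintro _ rfl; simp [Config.next]
  inPort_active := by rintro _ rfl; simp [Config.next]
  state_active := by rintro _ rfl; simp [Config.next]
  board_active := by rintro _ rfl; simp [Config.next]
  pos_idle := by intro b hb; exact Function.update_of_ne hb _ _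
  inPort_idle := by intro b hb; exact Function.update_of_ne hb _ _
  state_idle := by intro b hb; exact Function.update_of_ne hb _ _
  board_idle := by classical intro v hv; exact Function.update_of_ne (hv a rfl).symm _ _
  exchange := fun _ => rfl

/-- The configuration reached from `c` when agents act one by one in the order of a list. -/
noncomputable def Config.after (c : Config A k V) (l : List (Fin k)) : Config A k V :=
  l.foldl (fun c a => c.next N ids a) c

theorem Config.after_append (c : Config A k V) (l l' : List (Fin k)) :
    c.after N ids (l ++ l') = (c.after N ids l).after N ids l' :=
  List.foldl_append

/-- If every agent can be made to move from every configuration, then no agent rests forever in a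
suitable execution. -/
theorem exists_execution_moving [NeZero k] (c₀ : Config A k V) (h₀ : ∀ a, a ∈ c₀.know a)
    (hmove : ∀ (c : Config A k V) (a : Fin k), ∃ l, (c.after N ids l).pos a ≠ c.pos a) :
    ∃ e : Execution A N ids, ∀ a T, ∃ t, T ≤ t ∧ (e.conf t).pos a ≠ (e.conf T).pos a := by
  choose w hw using hmove
  obtain ⟨g, hg⟩ := exists_seq_frequently (Fin k)
  -- Stage `n` appends a nonempty schedule that moves the agent `g n`. Hence `L n` has length at
  -- least `n`, and its first `n` letters are never revised.
  let L : ℕ → List (Fin k) := fun n =>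
    Nat.rec [] (fun n l => l ++ w (c₀.after N ids l) (g n)) n
  have hL : ∀ n, L (n + 1) = L n ++ w (c₀.after N ids (L n)) (g n) := fun n => rfl
  have hpre : ∀ {m n}, m ≤ n → L m <+: L n := by
    intro m n h
    induction n, h using Nat.le_induction with
    | base => exact List.prefix_rfl
    | succ n _ ih => exact ih.trans (hL n ▸ List.prefix_append _ _)
  have hlen : ∀ n, n ≤ (L n).length := by
    intro n
    induction n with
    | zero => exact Nat.zero_le _
    | succ n ih =>
      have h1 : w (c₀.after N ids (L n)) (g n) ≠ [] := by
        intro h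
        have := hw (c₀.after N ids (L n)) (g n)
        rw [h] at this
        exact this rfl
      have h2 := List.length_pos_iff.2 h1
      rw [hL, List.length_append]
      omega
  have htake : ∀ {m n t}, t ≤ (L m).length → m ≤ n → (L n).take t = (L m).take t := by
    intro m n t ht hmn
    obtain ⟨r, hr⟩ := hpre hmn
    rw [← hr, List.take_append_of_le_length ht]
  let conf : ℕ → Config A k V := fun t => c₀.after N ids ((L t).take t)
  let σ : ℕ → Fin k := fun t => (L (t + 1))[t]'(hlen (t + 1))
  have hsucc : ∀ t, conf (t + 1) = (conf t).next N ids (σ t) := by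
    intro t
    change c₀.after N ids ((L (t + 1)).take (t + 1)) = _
    rw [List.take_succ_eq_append_getElem (hlen (t + 1)), Config.after_append,
      htake (hlen t) (Nat.le_succ t)]
    rfl
  have hstep : ∀ t, Step N ids {σ t} (conf t) (conf (t + 1)) := fun t =>
    hsucc t ▸ Config.step_next N ids _ _
  have hconf : ∀ n, conf (L n).length = c₀.after N ids (L n) := by
    intro n
    change c₀.after N ids _ = _
    rw [htake le_rfl (hlen n), List.take_length]
  have hmv : ∀ a T, ∃ s, T ≤ s ∧ ∃ t, s ≤ t ∧ (conf t).pos a ≠ (conf s).pos a := by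
    intro a T
    obtain ⟨n, hn, rfl⟩ := hg a T
    refine ⟨(L n).length, hn.trans (hlen n), (L (n + 1)).length,
      (hpre (Nat.le_succ n)).length_le, ?_⟩
    rw [hconf n, hconf (n + 1), hL, Config.after_append]
    exact hw _ _
  refine ⟨⟨conf, fun t => {σ t}, ?_, hstep, ?_⟩, ?_⟩
  · intro a
    exact h₀ a
  -- Fairness comes for free: an agent that moves after `T` must have acted after `T`.
  · intro a T
    obtain ⟨s, hs, t, ht, hne⟩ := hmv a T
    by_contra! hcon
    apply hne
    clear hne
    induction t, ht using Nat.le_induction with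
    | base => rfl
    | succ t ht ih =>
      rw [(hstep t).pos_idle a (hcon t (hs.trans ht)), ih]
  · intro a T
    obtain ⟨s, hs, t, ht, hne⟩ := hmv a T
    -- Two later positions differ from each other, so at least one of them differs from the position
    -- at time `T`.
    by_cases h : (conf s).pos a = (conf T).pos a
    · exact ⟨t, hs.trans ht, h ▸ hne⟩
    · exact ⟨s, hs, h⟩

end SingleSteps

-- If `a` never moves whatever the schedule, choose a reachable configuration minimizing the number
-- of agents at its node. When only these agents act, nobody joins them, and by minimality nobody
-- leaves; a fair schedule of the group is then a stall.
open Classical in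
theorem exists_move_of_no_stall {A : Algorithm} {k : ℕ} (ids : Fin k ↪ ℕ)
    (hns : ∀ S : Finset ℕ, S.Nonempty → (∀ i ∈ S, i ∈ Set.range ids) → Stall A S → False)
    (c : Config A k Bool) (a : Fin k) :
    ∃ l, (c.after twoPath ids l).pos a ≠ c.pos a := by
  by_contra! hcon
  let grp : List (Fin k) → Finset (Fin k) := fun l =>
    Finset.univ.filter fun b => (c.after twoPath ids l).pos b = c.pos a
  obtain ⟨l₀, hl₀⟩ : ∃ l₀, ∀ l, (grp l₀).card ≤ (grp l).card :=
    ⟨_, fun l => Function.argmin_le (fun l => (grp l).card) l⟩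
  have hmg : ∀ l b, b ∈ grp l ↔ (c.after twoPath ids l).pos b = c.pos a := by
    intro l b
    simp [grp]
  have ha : a ∈ grp l₀ := (hmg _ _).2 (hcon l₀)
  have hnext : ∀ l b, (c.after twoPath ids (l ++ [b])) =
      (c.after twoPath ids l).next twoPath ids b := by
    intro l b
    rw [Config.after_append]
    rfl
  have hgrp : ∀ l, (∀ b ∈ l, b ∈ grp l₀) → grp (l₀ ++ l) = grp l₀ := by
    intro l
    induction l using List.reverseRecOn with
    | nil => intro _; rw [List.append_nil]
    | append_singleton l b ih =>
      intro hl
      have ih' := ih fun x hx => hl x (by simp [hx])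
      refine Finset.eq_of_subset_of_card_le ?_ (hl₀ _)
      intro x hx
      by_cases hxb : x = b
      · exact hxb ▸ hl b (by simp)
      · rw [← ih', hmg]
        rw [hmg, ← List.append_assoc, hnext] at hx
        rw [← hx]
        exact (Function.update_of_ne hxb _ _).symm
  have : Nonempty (grp l₀) := ⟨⟨a, ha⟩⟩
  obtain ⟨g, hg⟩ := exists_seq_frequently (grp l₀)
  let lst : ℕ → List (Fin k) := fun t => (List.range t).map fun n => (g n : Fin k)
  have hlst : ∀ t, lst (t + 1) = lst t ++ [(g t : Fin k)] := by
    intro t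
    simp [lst, List.range_succ]
  have hlst_mem : ∀ t, ∀ b ∈ lst t, b ∈ grp l₀ := by
    intro t b hb
    obtain ⟨n, _, rfl⟩ := List.mem_map.1 hb
    exact (g n).2
  let conf : ℕ → Config A k Bool := fun t => c.after twoPath ids (l₀ ++ lst t)
  have hconf : ∀ t, conf (t + 1) = (conf t).next twoPath ids (g t) := by
    intro t
    change c.after twoPath ids (l₀ ++ lst (t + 1)) = _
    rw [hlst, ← List.append_assoc, hnext]
  have hin : ∀ t b, b ∈ grp l₀ ↔ (conf t).pos b = c.pos a := by
    intro t b
    rw [← hgrp (lst t) (hlst_mem t), hmg]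
  have hstay : ∀ t, twoPath.dest ((conf t).pos (g t)) ((conf t).action twoPath ids (g t)).2.2 =
      (conf t).pos (g t) := by
    intro t
    have h1 := (hin (t + 1) (g t)).1 (g t).2
    rw [hconf] at h1
    simp only [Config.next, Function.update_self, Config.target] at h1
    rw [h1, (hin t (g t)).1 (g t).2]
  -- Arrival labels change only through migration, so they are frozen; this is why the `inPort` of a
  -- stall does not depend on time.
  have hip : ∀ t, (conf t).inPort = (conf 0).inPort := by
    intro t
    induction t with
    | zero => rfl
    | succ t ih =>
      rw [hconf, ← ih]
      simp only [Config.next, Network.inLabel, if_pos (hstay t), Function.update_eq_self]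
  have : Nonempty (Fin k) := ⟨a⟩
  -- A stall is indexed by identifiers; the values of `inv` outside the range of `ids` do not
  -- matter.
  let inv : ℕ → Fin k := Function.invFun ids
  have hinv : ∀ b, inv (ids b) = b := Function.leftInverse_invFun ids.injective
  refine hns ((grp l₀).map ids) ⟨ids a, Finset.mem_map_of_mem _ ha⟩ ?_
    { inPort := fun i => (conf 0).inPort (inv i)
      actor := fun t => ids (g t)
      state := fun t i => (conf t).state (inv i)
      board := fun t => (conf t).board (c.pos a)
      actor_mem := fun t => Finset.mem_map_of_mem _ (g t).2
      fair := ?_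
      result := fun t => (conf t).action twoPath ids (g t)
      result_eq := ?_
      stay := ?_
      state_actor := ?_
      state_other := ?_
      board_succ := ?_ }
  · intro i hi
    obtain ⟨b, _, rfl⟩ := Finset.mem_map.1 hi
    exact ⟨b, rfl⟩
  · intro i hi t
    obtain ⟨b, hb, rfl⟩ := Finset.mem_map.1 hi
    obtain ⟨s, hs, h⟩ := hg ⟨b, hb⟩ t
    exact ⟨s, hs, by rw [h]⟩
  · intro t
    have hoth : (conf t).others ids (g t) =
        companions ((grp l₀).map ids) (fun i => (conf t).state (inv i)) (ids (g t)) := by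
      ext ⟨i, s⟩
      simp only [Config.others, companions, Set.Finite.mem_toFinset, Set.mem_image,
        Set.mem_ofPred_eq, Finset.mem_map]
      constructor
      · rintro ⟨b, ⟨hb, hp⟩, h⟩
        refine ⟨ids b, ⟨⟨b, (hin t b).2 (hp.trans ((hin t _).1 (g t).2)), rfl⟩,
          fun h' => hb (ids.injective h')⟩, ?_⟩
        rw [← h, hinv]
      · rintro ⟨_, ⟨⟨b, hb, rfl⟩, hne⟩, h⟩
        refine ⟨b, ⟨fun h' => hne (h' ▸ rfl), ?_⟩, ?_⟩
        · rw [(hin t b).1 hb, (hin t _).1 (g t).2]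
        · rw [← h, hinv]
    simp only [Config.action, hinv, twoPath_ports, hoth, hip t, (hin t _).1 (g t).2]
  · intro t h
    have h1 := hstay t
    rw [h, twoPath.dest_eq_self_iff, twoPath_ports] at h1
    exact h1 (Finset.mem_singleton_self 0)
  · intro t
    simp only [hinv, hconf, Config.next, Function.update_self]
  · intro t j hj hne
    obtain ⟨b, hb, rfl⟩ := Finset.mem_map.1 hj
    have hb' : b ≠ g t := fun h => hne (h ▸ rfl)
    simp only [hinv, hconf, Config.next, Function.update_of_ne hb']
  · intro t
    simp only [hconf, Config.next, (hin t _).1 (g t).2, Function.update_self]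

theorem exists_stall_of_isQuiescent {A : Algorithm} {k l : ℕ} (hk : 1 ≤ k) (hl : 1 ≤ l)
    (hA : A.IsQuiescent k l) (ids : Fin k ↪ ℕ) :
    ∃ S : Finset ℕ, S.Nonempty ∧ (∀ i ∈ S, i ∈ Set.range ids) ∧ Nonempty (Stall A S) := by
  by_contra! hcon
  have : NeZero k := ⟨by omega⟩
  obtain ⟨s₀⟩ := A.state_nonempty
  obtain ⟨b₀⟩ := A.board_nonempty
  obtain ⟨e, he⟩ := exists_execution_moving twoPath ids
    (⟨fun _ => true, fun _ => none, fun _ => s₀, fun _ => b₀, fun a => {a}⟩ : Config A k Bool)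
    (fun a => rfl)
    (exists_move_of_no_stall ids fun S h1 h2 h3 => (hcon S h1 h2).false h3)
  obtain ⟨T, Q, hQ, h⟩ := hA Bool twoPath ids e
  obtain ⟨a, ha⟩ := Finset.card_pos.1 (lt_of_lt_of_le hl hQ)
  obtain ⟨t, ht, hne⟩ := he a T
  exact hne (h a ha t ht)

/-- Quiescence is used twice, with the identifiers below `k` and with those from `k` to `2k - 1`, to
obtain two stalls with disjoint identifier sets. -/
theorem Algorithm.SolvesGossip.not_isQuiescent {A : Algorithm} (hA : A.SolvesGossip) {k l : ℕ}
    (hk : 1 ≤ k) (hl : 1 ≤ l) : ¬ A.IsQuiescent k l := by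
  intro hq
  have h : ∀ b : Bool, ∃ S : Finset ℕ, S.Nonempty ∧
      (∀ i ∈ S, if b then i < k else k ≤ i) ∧ Nonempty (Stall A S) := by
    rintro (_ | _)
    · obtain ⟨S, h1, h2, h3⟩ := exists_stall_of_isQuiescent hk hl hq
        ⟨fun a => k + a, fun a b h => Fin.ext (Nat.add_left_cancel h)⟩
      refine ⟨S, h1, fun i hi => ?_, h3⟩
      obtain ⟨a, rfl⟩ := h2 i hi
      exact Nat.le_add_right k a
    · obtain ⟨S, h1, h2, h3⟩ := exists_stall_of_isQuiescent hk hl hq Fin.valEmbedding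
      refine ⟨S, h1, fun i hi => ?_, h3⟩
      obtain ⟨a, rfl⟩ := h2 i hi
      simp
  choose S h1 h2 h3 using h
  refine not_solvesGossip_of_stall (fun b => (h3 b).some) h1 ?_ hA
  rw [Finset.disjoint_left]
  intro i hi hi'
  have := h2 true i hi
  have := h2 false i hi'
  simp at *
  omega

/-! ### Rooted trees and directions in them -/

/-- A rooted tree on the nodes, given by their parents and depths. -/
structure RootedTree (V : Type) where
  root : V
  parent : V → V
  depth : V → ℕ
  parent_root : parent root = root
  depth_parent : ∀ v, v ≠ root → depth v = depth (parent v) + 1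

namespace RootedTree

variable {V : Type} (T : RootedTree V)

/-- `u` is an ancestor of `v`, possibly `v` itself. -/
def Anc (u v : V) : Prop := ∃ n : ℕ, T.parent^[n] v = u

/-- `y` is `x`, its parent or one of its children. -/
def Near (x y : V) : Prop := y = x ∨ y = T.parent x ∨ x = T.parent y

/-- `w` is the neighbour of `v` on the way to `x`. -/
def Toward (v x w : V) : Prop :=
  (T.Anc v x ∧ T.parent w = v ∧ T.Anc w x ∧ w ≠ v) ∨ (¬ T.Anc v x ∧ w = T.parent v)

variable {T}

theorem anc_refl (v : V) : T.Anc v v := ⟨0, rfl⟩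

theorem anc_parent_iff {u v : V} (h : v ≠ u) : T.Anc u (T.parent v) ↔ T.Anc u v := by
  constructor
  · rintro ⟨n, hn⟩
    exact ⟨n + 1, hn⟩
  · rintro ⟨_ | n, hn⟩
    · exact absurd hn h
    · exact ⟨n, hn⟩

theorem anc_root (v : V) : T.Anc T.root v := by
  induction hd : T.depth v generalizing v with
  | zero =>
    by_cases h : v = T.root
    · exact h ▸ anc_refl v
    · have := T.depth_parent v h
      omega
  | succ n ih =>
    by_cases h : v = T.root
    · exact h ▸ anc_refl v
    · rw [← anc_parent_iff h]
      apply ih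
      have := T.depth_parent v h
      omega

theorem eq_root_of_anc {u : V} (h : T.Anc u T.root) : u = T.root := by
  obtain ⟨n, rfl⟩ := h
  exact Function.iterate_fixed T.parent_root n

/-- A pointer left at departure along a tree link is correct at once. In the upward case, `x` is not
an ancestor of its parent because depths do not increase along iterated parents. -/
theorem toward_self_step {x y : V} (h : T.Near x y) (hne : y ≠ x) : T.Toward x y y := by
  rcases h with h | rfl | rfl
  · exact absurd h hne
  · refine Or.inr ⟨?_, rfl⟩
    rintro ⟨n, hn⟩
    by_cases hx : x = T.root
    · rw [hx, T.parent_root] at hne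
      exact hne rfl
    · have key : ∀ m z, T.depth (T.parent^[m] z) ≤ T.depth z := by
        intro m
        induction m with
        | zero => intro z; exact le_rfl
        | succ m ih =>
          intro z
          rw [Function.iterate_succ_apply]
          refine (ih _).trans ?_
          by_cases hz : z = T.root
          · rw [hz, T.parent_root]
          · rw [T.depth_parent z hz]
            exact Nat.le_succ _
      have h1 := key n (T.parent x)
      rw [hn, T.depth_parent x hx] at h1
      omega
  · exact Or.inl ⟨⟨1, rfl⟩, rfl, anc_refl y, hne⟩

/-- A target moving along a tree link cannot change branches at `v` without passing through `v`. -/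
theorem Toward.step {v x y w : V} (h : T.Toward v x w) (hxy : T.Near x y) (hx : v ≠ x)
    (hy : v ≠ y) : T.Toward v y w := by
  rcases hxy with rfl | rfl | rfl
  · exact h
  · rw [Toward, anc_parent_iff hx.symm]
    refine h.imp (fun ⟨h1, h2, h3, h4⟩ => ⟨h1, h2, ?_, h4⟩) id
    refine (anc_parent_iff ?_).2 h3
    rintro rfl
    exact hy h2.symm
  · rw [Toward, ← anc_parent_iff hy.symm]
    exact h.imp (fun ⟨h1, h2, ⟨n, hn⟩, h4⟩ => ⟨h1, h2, ⟨n + 1, hn⟩, h4⟩) id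

end RootedTree

/-! ### Pursuit of a searcher that sweeps a tree -/

section Pursuit

variable {V : Type}

/-- From time `s` on, `Q` moves only along the links `ptr` by which `P` has last left the nodes, and
does not cross `P`. -/
structure Pursuit (P Q : ℕ → V) (ptr : ℕ → V → V) (s : ℕ) : Prop where
  ptr_other : ∀ t, s ≤ t → ∀ v, v ≠ P t → ptr (t + 1) v = ptr t v
  ptr_move : ∀ t, s ≤ t → P (t + 1) ≠ P t → ptr (t + 1) (P t) = P (t + 1)
  chase : ∀ t, s ≤ t → Q (t + 1) = Q t ∨ Q (t + 1) = ptr t (Q t)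
  no_cross : ∀ t, s ≤ t → P (t + 1) = Q t → Q (t + 1) = P t → P t = Q t

/-- Between `s` and `e`, `P` traverses the tree, visits all nodes and returns to the root. -/
structure Sweep (T : RootedTree V) (P : ℕ → V) (s e : ℕ) : Prop where
  le : s ≤ e
  near : ∀ t, s ≤ t → t < e → T.Near (P t) (P (t + 1))
  visit : ∀ v, ∃ t, s ≤ t ∧ t ≤ e ∧ P t = v
  root : P e = T.root

/-- Consecutive sweeps. -/
inductive Sweeps (T : RootedTree V) (P : ℕ → V) : ℕ → ℕ → ℕ → Prop
  | nil (s : ℕ) : Sweeps T P 0 s s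
  | cons {n s m e : ℕ} : Sweep T P s m → Sweeps T P n m e → Sweeps T P (n + 1) s e

theorem Sweeps.le {T : RootedTree V} {P : ℕ → V} {n s e : ℕ} (h : Sweeps T P n s e) : s ≤ e := by
  induction h with
  | nil s => exact le_rfl
  | cons h1 _ ih => exact h1.le.trans ih

variable {T : RootedTree V} {P Q : ℕ → V} {ptr : ℕ → V → V} {s₀ s e : ℕ}

theorem Pursuit.toward_mono (h : Pursuit P Q ptr s₀) (hs : s₀ ≤ s)
    (hnear : ∀ t, s ≤ t → t < e → T.Near (P t) (P (t + 1))) {v : V} {a : ℕ} (ha : s ≤ a)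
    (hv : v ≠ P a → T.Toward v (P a) (ptr a v)) {t : ℕ} (hat : a ≤ t) (hte : t ≤ e) :
    v ≠ P t → T.Toward v (P t) (ptr t v) := by
  induction t, hat using Nat.le_induction with
  | base => exact hv
  | succ t hat ih =>
    intro hne
    have ih' := ih (by omega)
    have hst : s₀ ≤ t := by omega
    have hn := hnear t (ha.trans hat) (by omega)
    by_cases hvt : v = P t
    · subst hvt
      rw [h.ptr_move t hst hne.symm]
      exact RootedTree.toward_self_step hn hne.symm
    · rw [h.ptr_other t hst v hvt]
      exact (ih' hvt).step hn hvt hne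

/-- Each node is visited during the sweep, which makes its pointer correct, and
`Pursuit.toward_mono` keeps it correct. -/
theorem Pursuit.toward_of_sweep (h : Pursuit P Q ptr s₀) (hs : s₀ ≤ s) (hsw : Sweep T P s e)
    (v : V) : v ≠ P e → T.Toward v (P e) (ptr e v) := by
  obtain ⟨a, ha, hae, hv⟩ := hsw.visit v
  exact h.toward_mono hs hsw.near ha (fun hne => absurd hv.symm hne) hae le_rfl

theorem Pursuit.depth_lt (h : Pursuit P Q ptr s₀) (hs : s₀ ≤ s) (hsw : Sweep T P s e)
    (hne : ∀ t, s ≤ t → P t ≠ Q t) (hto : ∀ v, v ≠ P s → T.Toward v (P s) (ptr s v)) :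
    T.depth (Q e) < T.depth (Q s) := by
  have hto' : ∀ t, s ≤ t → t ≤ e → ∀ v, v ≠ P t → T.Toward v (P t) (ptr t v) :=
    fun t h1 h2 v => h.toward_mono hs hsw.near le_rfl (hto v) h1 h2
  -- An ancestor of `P` remains one: its pointer leads to a child that is still an ancestor of `P`.
  -- The only escape is that this child is the position of `P` while `P` climbs to `Q`, a crossing
  -- excluded by `no_cross`.
  have hdoom : ∀ t, s ≤ t → t < e → T.Anc (Q t) (P t) → T.Anc (Q (t + 1)) (P (t + 1)) := by
    intro t hst hte hanc
    have hn := hsw.near t hst hte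
    have hq := hne t hst
    have hq' := hne (t + 1) (by omega)
    have hx := h.no_cross t (hs.trans hst)
    have move : ∀ u, T.Anc u (P t) → u ≠ P t ∨ P (t + 1) ≠ T.parent (P t) ∨ P (t + 1) = P t →
        T.Anc u (P (t + 1)) := by
      intro u hu hcase
      rcases hn with h1 | h1 | h1
      · rwa [h1]
      · by_cases h2 : P (t + 1) = P t
        · rwa [h2]
        · rw [h1]
          refine (RootedTree.anc_parent_iff ?_).2 hu
          rintro rfl
          tauto
      · obtain ⟨n, hn⟩ := hu
        exact ⟨n + 1, by rw [Function.iterate_succ_apply, ← h1, hn]⟩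
    rcases h.chase t (hs.trans hst) with h1 | h1
    · rw [h1]
      exact move _ hanc (Or.inl hq.symm)
    · rcases hto' t hst hte.le (Q t) hq.symm with ⟨_, h2, h3, h4⟩ | ⟨h2, _⟩
      · rw [h1]
        refine move _ h3 ?_
        by_cases h5 : ptr t (Q t) = P t
        · right
          left
          intro h6
          rw [h5] at h2
          rw [h1] at hx
          exact hq (hx (h6.trans h2) h5)
        · exact Or.inl h5
      · exact absurd hanc h2
  -- Otherwise `Q` would be an ancestor of `P` at time `e`, hence at the root together with `P`.
  have hnot : ∀ t, s ≤ t → t ≤ e → ¬ T.Anc (Q t) (P t) := by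
    intro t hst hte hanc
    have hall : ∀ t', t ≤ t' → t' ≤ e → T.Anc (Q t') (P t') := by
      intro t' htt'
      induction t', htt' using Nat.le_induction with
      | base => exact fun _ => hanc
      | succ t' h1 ih => exact fun h2 => hdoom t' (hst.trans h1) (by omega) (ih (by omega))
    have h1 := hall e hte le_rfl
    rw [hsw.root] at h1
    apply hne e hsw.le
    rw [hsw.root, RootedTree.eq_root_of_anc h1]
  have hstep : ∀ t, s ≤ t → t < e →
      Q (t + 1) = Q t ∨ T.depth (Q (t + 1)) < T.depth (Q t) := by
    intro t hst hte
    rcases h.chase t (hs.trans hst) with h1 | h1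
    · exact Or.inl h1
    · right
      rcases hto' t hst hte.le (Q t) (hne t hst).symm with ⟨h2, _⟩ | ⟨h2, h3⟩
      · exact absurd h2 (hnot t hst hte.le)
      · rw [h1, h3, T.depth_parent (Q t)]
        · exact Nat.lt_succ_self _
        · intro h4
          exact h2 (h4 ▸ RootedTree.anc_root _)
  have hmono : ∀ t, s ≤ t → t ≤ e → Q t = Q s ∨ T.depth (Q t) < T.depth (Q s) := by
    intro t hst
    induction t, hst using Nat.le_induction with
    | base => exact fun _ => Or.inl rfl
    | succ t h1 ih =>
      intro h2
      rcases ih (by omega) with h3 | h3 <;> rcases hstep t h1 (by omega) with h4 | h4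
      · exact Or.inl (h4.trans h3)
      · exact Or.inr (h3 ▸ h4)
      · exact Or.inr (h4 ▸ h3)
      · exact Or.inr (h4.trans h3)
  have hanti : ∀ t, s ≤ t → ∀ t', t ≤ t' → t' ≤ e → T.depth (Q t') ≤ T.depth (Q t) := by
    intro t hst t' htt'
    induction t', htt' using Nat.le_induction with
    | base => exact fun _ => le_rfl
    | succ t' h1 ih =>
      intro h2
      have h3 := ih (by omega)
      rcases hstep t' (hst.trans h1) (by omega) with h4 | h4
      · rwa [h4]
      · omega
  -- When `P` visits the starting node of `Q`, `Q` must already have left it, and it leaves a node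
  -- only by climbing.
  obtain ⟨a, ha, hae, hv⟩ := hsw.visit (Q s)
  rcases hmono a ha hae with h1 | h1
  · exact absurd (hv.trans h1.symm) (hne a ha)
  · exact (hanti a ha e hae le_rfl).trans_lt h1

theorem Pursuit.depth_add_le (h : Pursuit P Q ptr s₀) {n : ℕ} (hsw : Sweeps T P n s e)
    (hs : s₀ ≤ s) (hne : ∀ t, s ≤ t → P t ≠ Q t)
    (hto : ∀ v, v ≠ P s → T.Toward v (P s) (ptr s v)) :
    T.depth (Q e) + n ≤ T.depth (Q s) := by
  induction hsw with
  | nil s => exact le_rfl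
  | cons h1 h2 ih =>
    have h3 := ih (hs.trans h1.le) (fun t ht => hne t (h1.le.trans ht)) (h.toward_of_sweep hs h1)
    have h4 := h.depth_lt hs h1 hne hto
    omega

/-- A searcher which sweeps a tree sufficiently often meets everyone who follows its trail. -/
theorem Pursuit.exists_meet [Finite V] (h : Pursuit P Q ptr s₀)
    (hsw : ∀ n t, ∃ s e, t ≤ s ∧ Sweeps T P n s e) (t : ℕ) : ∃ t', t ≤ t' ∧ P t' = Q t' := by
  by_contra! hcon
  obtain ⟨D, hD⟩ := (Set.finite_range T.depth).bddAbove
  -- One sweep corrects the pointers; the other `D + 1` would lower a depth that is at most `D`.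
  obtain ⟨s, e, hts, hs⟩ := hsw (D + 1 + 1) (max t s₀)
  cases hs with
  | cons h1 h2 =>
    have h3 := h.depth_add_le h2 (by have := h1.le; omega)
      (fun t' ht' => hcon t' (by have := h1.le; omega))
      (h.toward_of_sweep (by omega) h1)
    exact absurd (h3.trans (hD (Set.mem_range_self _))) (by omega)

end Pursuit

/-! ### The universal word -/

/-- A sequence of link labels in which every finite word occurs infinitely often. -/
def universalWord (c : ℕ) : ℕ :=
  ((Encodable.decode (α := List ℕ) (Nat.unpair (Nat.log 2 c)).1).getD []).getD
    (c - 2 ^ Nat.log 2 c) 0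

/-- The positions from `2 ^ m` to `2 ^ (m + 1) - 1` spell the word coded by the first component of
`m`, padded with zeros. The second component, `n + w.length`, is free and puts the block beyond `n`
with room for `w`. -/
theorem universalWord_occurs (w : List ℕ) (n : ℕ) :
    ∃ c, n ≤ c ∧ ∀ i < w.length, universalWord (c + i) = w.getD i 0 := by
  set m := Nat.pair (Encodable.encode w) (n + w.length) with hm
  have h1 : n + w.length ≤ m := Nat.right_le_pair _ _
  have h2 : m < 2 ^ m := Nat.lt_two_pow_self
  refine ⟨2 ^ m, by omega, fun i hi => ?_⟩
  have h3 : Nat.log 2 (2 ^ m + i) = m := by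
    rw [Nat.log_eq_iff (Or.inr ⟨by omega, by omega⟩), pow_succ]
    omega
  rw [universalWord, h3, hm, Nat.unpair_pair, Encodable.encodek, ← hm]
  simp

/-! ### Words of labels and sweeps of a spanning tree -/

section Words

variable {V : Type} (N : Network V)

/-- The node reached from `x` by following the links labelled by the letters of a word. -/
noncomputable def Network.run (x : V) (w : List ℕ) : V :=
  w.foldl (fun v p => N.dest v (some p)) x

theorem Network.run_append (x : V) (w w' : List ℕ) :
    N.run x (w ++ w') = N.run (N.run x w) w' :=
  List.foldl_append

theorem Network.run_cons (x : V) (p : ℕ) (w : List ℕ) :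
    N.run x (p :: w) = N.run (N.dest x (some p)) w :=
  rfl

/-- The walk from `x` along a word uses links of the tree only. -/
def Network.TreeRun (T : RootedTree V) : V → List ℕ → Prop
  | _, [] => True
  | x, p :: w => T.Near x (N.dest x (some p)) ∧ Network.TreeRun T (N.dest x (some p)) w

/-- The walk from `x` along a word visits `v`. -/
def Network.Visits (x : V) (w : List ℕ) (v : V) : Prop :=
  ∃ w₁ w₂, w = w₁ ++ w₂ ∧ N.run x w₁ = v

variable {N}

theorem Network.TreeRun.append {T : RootedTree V} {w w' : List ℕ} {x : V} (h : N.TreeRun T x w)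
    (h' : N.TreeRun T (N.run x w) w') : N.TreeRun T x (w ++ w') := by
  induction w generalizing x with
  | nil => exact h'
  | cons p w ih => exact ⟨h.1, ih h.2 h'⟩

theorem Network.Visits.append_right {x v : V} {w : List ℕ} (h : N.Visits x w v) (w' : List ℕ) :
    N.Visits x (w ++ w') v := by
  obtain ⟨w₁, w₂, rfl, h⟩ := h
  exact ⟨w₁, w₂ ++ w', List.append_assoc _ _ _, h⟩

/-- The starting nodes are treated one after another: for each new one, a good word is appended from
wherever the word built so far leads. Later additions spoil nothing, since the good factor may sit
anywhere. -/
theorem Network.exists_word_forall [Finite V] {G : V → List ℕ → Prop} (hG : ∀ x, ∃ w, G x w) :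
    ∃ w, ∀ x, ∃ w₁ w₂ w₃, w = w₁ ++ w₂ ++ w₃ ∧ G (N.run x w₁) w₂ := by
  classical
  have := Fintype.ofFinite V
  have key : ∀ l : List V, ∃ w, ∀ x ∈ l, ∃ w₁ w₂ w₃, w = w₁ ++ w₂ ++ w₃ ∧ G (N.run x w₁) w₂ := by
    intro l
    induction l with
    | nil => exact ⟨[], by simp⟩
    | cons y l ih =>
      obtain ⟨w, hw⟩ := ih
      obtain ⟨w', hw'⟩ := hG (N.run y w)
      refine ⟨w ++ w', fun x hx => ?_⟩
      rcases List.mem_cons.1 hx with rfl | hx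
      · exact ⟨w, w', [], by simp, hw'⟩
      · obtain ⟨w₁, w₂, w₃, rfl, h⟩ := hw x hx
        exact ⟨w₁, w₂, w₃ ++ w', by simp, h⟩
  obtain ⟨w, hw⟩ := key Finset.univ.toList
  exact ⟨w, fun x => hw x (by simp)⟩

variable (N) in
/-- The network has a link between every node and its parent. -/
def Network.Spans (T : RootedTree V) : Prop := ∀ v, v ≠ T.root → N.graph.Adj v (T.parent v)

variable (N) in
-- The tree is a breadth-first tree: parents are neighbours closer to the root, depth is graph
-- distance.
theorem Network.exists_spans [Nonempty V] : ∃ T : RootedTree V, N.Spans T := by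
  classical
  obtain ⟨r⟩ := ‹Nonempty V›
  have h : ∀ v, v ≠ r → ∃ w, N.graph.Adj v w ∧ N.graph.dist v r = N.graph.dist w r + 1 := by
    intro v hv
    obtain ⟨p, hp⟩ := (N.connected.preconnected v r).exists_walk_length_eq_dist
    cases p with
    | nil => exact absurd rfl hv
    | @cons _ w _ hadj q =>
      refine ⟨w, hadj, le_antisymm ?_ ?_⟩
      · obtain ⟨q', hq'⟩ := (N.connected.preconnected w r).exists_walk_length_eq_dist
        rw [← hq']
        exact SimpleGraph.dist_le (SimpleGraph.Walk.cons hadj q')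
      · rw [← hp, SimpleGraph.Walk.length_cons]
        exact Nat.succ_le_succ (SimpleGraph.dist_le q)
  choose f hf using h
  refine ⟨⟨r, fun v => if hv : v = r then r else f v hv, fun v => N.graph.dist v r, by simp,
    fun v hv => ?_⟩, fun v hv => ?_⟩
  · simpa only [dif_neg hv] using (hf v hv).2
  · have hv' : v ≠ r := hv
    simpa only [dif_neg hv'] using (hf v hv).1

variable {T : RootedTree V}

theorem Network.Spans.exists_word_up (hT : N.Spans T) (x : V) :
    ∃ w, N.TreeRun T x w ∧ N.run x w = T.root := by
  induction hd : T.depth x generalizing x with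
  | zero =>
    by_cases h : x = T.root
    · exact ⟨[], trivial, h⟩
    · have := T.depth_parent x h
      omega
  | succ n ih =>
    by_cases h : x = T.root
    · exact ⟨[], trivial, h⟩
    · obtain ⟨w, h1, h2⟩ := ih (T.parent x) (by have := T.depth_parent x h; omega)
      refine ⟨N.label x (T.parent x) :: w, ?_, ?_⟩
      · rw [Network.TreeRun, N.dest_label (hT x h)]
        exact ⟨Or.inr (Or.inl rfl), h1⟩
      · rwa [N.run_cons, N.dest_label (hT x h)]

theorem Network.Spans.exists_word_down (hT : N.Spans T) (x : V) :
    ∃ w, N.TreeRun T T.root w ∧ N.run T.root w = x := by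
  induction hd : T.depth x generalizing x with
  | zero =>
    by_cases h : x = T.root
    · exact ⟨[], trivial, h.symm⟩
    · have := T.depth_parent x h
      omega
  | succ n ih =>
    by_cases h : x = T.root
    · exact ⟨[], trivial, h.symm⟩
    · obtain ⟨w, h1, h2⟩ := ih (T.parent x) (by have := T.depth_parent x h; omega)
      have h3 : N.dest (T.parent x) (some (N.label (T.parent x) x)) = x :=
        N.dest_label (hT x h).symm
      refine ⟨w ++ [N.label (T.parent x) x], h1.append ?_, ?_⟩
      · rw [h2, Network.TreeRun, h3]
        exact ⟨Or.inr (Or.inr rfl), trivial⟩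
      · rw [N.run_append, h2, N.run_cons, h3]
        rfl

/-- A word along which a tree is swept. -/
structure Network.SweepWord (N : Network V) (T : RootedTree V) (x : V) (w : List ℕ) : Prop where
  treeRun : N.TreeRun T x w
  visits : ∀ v, N.Visits x w v
  root : N.run x w = T.root

theorem Network.Spans.exists_sweepWord [Finite V] (hT : N.Spans T) (x : V) :
    ∃ w, N.SweepWord T x w := by
  have := Fintype.ofFinite V
  have key : ∀ l : List V, ∃ w, N.TreeRun T x w ∧ (∀ v ∈ l, N.Visits x w v) ∧
      N.run x w = T.root := by
    intro l
    induction l with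
    | nil =>
      obtain ⟨w, h1, h2⟩ := hT.exists_word_up x
      exact ⟨w, h1, by simp, h2⟩
    | cons y l ih =>
      obtain ⟨w, h1, h2, h3⟩ := ih
      obtain ⟨w₁, h4, h5⟩ := hT.exists_word_down y
      obtain ⟨w₂, h6, h7⟩ := hT.exists_word_up y
      refine ⟨w ++ w₁ ++ w₂, (h1.append (by rwa [h3])).append ?_, fun v hv => ?_, ?_⟩
      · rwa [N.run_append, h3, h5]
      · rcases List.mem_cons.1 hv with rfl | hv
        · exact ⟨w ++ w₁, w₂, rfl, by rw [N.run_append, h3, h5]⟩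
        · exact ((h2 v hv).append_right _).append_right _
      · rw [N.run_append, N.run_append, h3, h5, h7]
  obtain ⟨w, h1, h2, h3⟩ := key Finset.univ.toList
  exact ⟨w, h1, fun v => h2 v (by simp), h3⟩

/-- A word along which a tree is swept `n` times. -/
def Network.SweepWords (N : Network V) (T : RootedTree V) : ℕ → V → List ℕ → Prop
  | 0, _, w => w = []
  | n + 1, x, w => ∃ w₁ w₂, w = w₁ ++ w₂ ∧ N.SweepWord T x w₁ ∧ Network.SweepWords N T n T.root w₂

theorem Network.Spans.exists_sweepWords [Finite V] (hT : N.Spans T) (n : ℕ) (x : V) :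
    ∃ w, N.SweepWords T n x w := by
  induction n generalizing x with
  | zero => exact ⟨[], rfl⟩
  | succ n ih =>
    obtain ⟨w₁, h1⟩ := hT.exists_sweepWord x
    obtain ⟨w₂, h2⟩ := ih T.root
    exact ⟨w₁ ++ w₂, w₁, w₂, rfl, h1, h2⟩

/-- From time `s` on, `P` follows the links labelled by the letters of the universal word, where
`c` counts the letters already used. -/
structure Roams (N : Network V) (P : ℕ → V) (c : ℕ → ℕ) (s : ℕ) : Prop where
  step : ∀ t, s ≤ t → (P (t + 1) = P t ∧ c (t + 1) = c t) ∨
    (P (t + 1) = N.dest (P t) (some (universalWord (c t))) ∧ c (t + 1) = c t + 1)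
  frequently : ∀ t, ∃ t', t ≤ t' ∧ c (t' + 1) = c t' + 1

variable {P : ℕ → V} {c : ℕ → ℕ} {s₀ : ℕ}

theorem Roams.exists_next (h : Roams N P c s₀) {s : ℕ} (hs : s₀ ≤ s) :
    ∃ t, s ≤ t ∧ (∀ t', s ≤ t' → t' ≤ t → P t' = P s ∧ c t' = c s) ∧
      P (t + 1) = N.dest (P s) (some (universalWord (c s))) ∧ c (t + 1) = c s + 1 := by
  classical
  have hex := h.frequently s
  obtain ⟨h1, h2⟩ := Nat.find_spec hex
  have hconst : ∀ t', s ≤ t' → t' ≤ Nat.find hex → P t' = P s ∧ c t' = c s := by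
    intro t' hst'
    induction t', hst' using Nat.le_induction with
    | base => exact fun _ => ⟨rfl, rfl⟩
    | succ t' hst' ih =>
      intro hle
      have ih' := ih (by omega)
      have hmin := Nat.find_min hex (m := t') (by omega)
      rcases h.step t' (hs.trans hst') with ⟨h3, h4⟩ | ⟨_, h4⟩
      · exact ⟨h3.trans ih'.1, h4.trans ih'.2⟩
      · exact absurd ⟨hst', h4⟩ hmin
  refine ⟨Nat.find hex, h1, hconst, ?_⟩
  obtain ⟨h3, h4⟩ := hconst _ h1 le_rfl
  rcases h.step _ (hs.trans h1) with ⟨_, h5⟩ | ⟨h5, h6⟩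
  · omega
  · rw [h5, h6, h3, h4]
    exact ⟨rfl, rfl⟩

theorem Roams.exists_count_eq (h : Roams N P c s₀) {s n : ℕ} (hs : s₀ ≤ s) (hn : c s ≤ n) :
    ∃ t, s ≤ t ∧ c t = n := by
  induction n, hn using Nat.le_induction with
  | base => exact ⟨s, le_rfl, rfl⟩
  | succ n _ ih =>
    obtain ⟨t, ht, rfl⟩ := ih
    obtain ⟨t', h1, _, _, h2⟩ := h.exists_next (hs.trans ht)
    exact ⟨t' + 1, by omega, h2⟩

theorem Roams.exists_performs (h : Roams N P c s₀) {s : ℕ} (hs : s₀ ≤ s) (w : List ℕ)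
    (hw : ∀ i < w.length, universalWord (c s + i) = w.getD i 0) :
    ∃ e, s ≤ e ∧ c e = c s + w.length ∧ P e = N.run (P s) w ∧
      (N.TreeRun T (P s) w → ∀ t, s ≤ t → t < e → T.Near (P t) (P (t + 1))) ∧
      ∀ v, N.Visits (P s) w v → ∃ t, s ≤ t ∧ t ≤ e ∧ P t = v := by
  induction w generalizing s with
  | nil =>
    refine ⟨s, le_rfl, rfl, rfl, fun _ t h1 h2 => by omega, fun v hv => ⟨s, le_rfl, le_rfl, ?_⟩⟩
    obtain ⟨w₁, w₂, h1, rfl⟩ := hv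
    obtain ⟨rfl, rfl⟩ := List.append_eq_nil_iff.1 h1.symm
    rfl
  | cons p w ih =>
    obtain ⟨m, h1, h2, h3, h4⟩ := h.exists_next hs
    have h5 : universalWord (c s) = p := hw 0 (by simp)
    rw [h5] at h3
    obtain ⟨e, h6, h7, h8, h9, h10⟩ := ih (s := m + 1) (by omega) (by
      intro i hi
      have := hw (i + 1) (by simpa using hi)
      rw [h4, add_assoc, add_comm 1 i, this]
      simp)
    rw [h3] at h8 h9 h10
    refine ⟨e, by omega, by rw [h7, h4, List.length_cons]; omega, h8, fun ht t hst hte => ?_,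
      fun v hv => ?_⟩
    · rcases lt_trichotomy t m with hlt | rfl | hlt
      · rw [(h2 t hst (by omega)).1, (h2 (t + 1) (by omega) hlt).1]
        exact Or.inl rfl
      · rw [h3, (h2 t hst le_rfl).1]
        exact ht.1
      · exact h9 ht.2 t hlt hte
    · obtain ⟨_ | ⟨q, w₁⟩, w₂, hw₁, rfl⟩ := hv
      · exact ⟨s, le_rfl, by omega, rfl⟩
      · obtain ⟨rfl, rfl⟩ := List.cons.inj hw₁
        obtain ⟨t, h11, h12, h13⟩ := h10 _ ⟨w₁, w₂, rfl, rfl⟩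
        exact ⟨t, by omega, h12, h13⟩

theorem Roams.exists_sweeps_of_word (h : Roams N P c s₀) {n s : ℕ} {w : List ℕ} (hs : s₀ ≤ s)
    (hw : ∀ i < w.length, universalWord (c s + i) = w.getD i 0)
    (hsw : N.SweepWords T n (P s) w) : ∃ e, Sweeps T P n s e := by
  induction n generalizing s w with
  | zero => exact ⟨s, Sweeps.nil s⟩
  | succ n ih =>
    obtain ⟨w₁, w₂, rfl, h1, h2⟩ := hsw
    obtain ⟨m, h3, h4, h5, h6, h7⟩ := h.exists_performs (T := T) hs w₁ (by
      intro i hi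
      rw [hw i (by rw [List.length_append]; omega), List.getD_append _ _ _ _ hi])
    obtain ⟨e, he⟩ := ih (s := m) (w := w₂) (hs.trans h3) (by
      intro i hi
      rw [h4, add_assoc, hw _ (by rw [List.length_append]; omega),
        List.getD_append_right _ _ _ _ (by omega), Nat.add_sub_cancel_left])
      (by rwa [h5, h1.root])
    exact ⟨e, Sweeps.cons ⟨h3, h6 h1.treeRun, fun v => h7 v (h1.visits v), h5.trans h1.root⟩ he⟩

theorem Roams.exists_sweeps [Finite V] (h : Roams N P c s₀) (hT : N.Spans T) (n t : ℕ) :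
    ∃ s e, t ≤ s ∧ Sweeps T P n s e := by
  -- The position of `P` at the start of an occurrence of the word is not under control, so the word
  -- must contain the sweeps from every starting node.
  obtain ⟨w, hw⟩ := N.exists_word_forall (hT.exists_sweepWords n)
  obtain ⟨m, hm, hocc⟩ := universalWord_occurs w (c (max t s₀))
  obtain ⟨s, hs, rfl⟩ := h.exists_count_eq (le_max_right t s₀) hm
  obtain ⟨w₁, w₂, w₃, rfl, h1⟩ := hw (P s)
  obtain ⟨s', h2, h3, h4, -, -⟩ := h.exists_performs (T := T) (s := s) (by omega) w₁ (by
    intro i hi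
    rw [hocc i (by simp only [List.length_append]; omega), List.append_assoc,
      List.getD_append _ _ _ _ hi])
  obtain ⟨e, he⟩ := h.exists_sweeps_of_word (s := s') (by omega) (w := w₂) (by
    intro i hi
    rw [h3, add_assoc, hocc _ (by simp only [List.length_append]; omega), List.append_assoc,
      List.getD_append_right _ _ _ _ (by omega), Nat.add_sub_cancel_left,
      List.getD_append _ _ _ _ hi]) (by rwa [h4])
  exact ⟨s', e, by omega, he⟩

theorem Roams.exists_visit_all [Finite V] (h : Roams N P c s₀) (t : ℕ) :
    ∃ e, t ≤ e ∧ ∀ v, ∃ t', t ≤ t' ∧ t' ≤ e ∧ P t' = v := by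
  have : Nonempty V := ⟨P 0⟩
  obtain ⟨T, hT⟩ := N.exists_spans
  obtain ⟨s, e, hs, hsw⟩ := h.exists_sweeps hT 1 t
  cases hsw with
  | cons h1 h2 =>
    refine ⟨_, hs.trans h1.le, fun v => ?_⟩
    obtain ⟨t', h3, h4, h5⟩ := h1.visit v
    exact ⟨t', hs.trans h3, h4, h5⟩

end Words

/-! ### Time-stamped trails -/

section Trail

variable {V : Type} {N : Network V} {P Q : ℕ → V} {c b : ℕ → ℕ} {E : ℕ → V → ℕ × ℕ} {s₀ : ℕ}

/-- From time `s` on, `P` follows the universal word and records at every node, in `E`, the time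
stamp and the link of its last departure. `Q` follows these links whenever their time stamps exceed
the last time stamp `b` which `Q` has followed. -/
structure Trailing (N : Network V) (P Q : ℕ → V) (c b : ℕ → ℕ) (E : ℕ → V → ℕ × ℕ) (s : ℕ) :
    Prop where
  roams : Roams N P c s
  entry_other : ∀ t, s ≤ t → ∀ v, v ≠ P t → E (t + 1) v = E t v
  entry_stay : ∀ t, s ≤ t → P (t + 1) = P t → E (t + 1) = E t
  entry_move : ∀ t, s ≤ t → P (t + 1) ≠ P t → c (t + 1) = c t + 1 ∧
    (E (t + 1) (P t)).1 = c t + 1 ∧ N.dest (P t) (some (E (t + 1) (P t)).2) = P (t + 1)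
  follow : ∀ t, s ≤ t → (Q (t + 1) = Q t ∧ b (t + 1) = b t) ∨
    (Q t ≠ P t ∧ b t < (E t (Q t)).1 ∧ Q (t + 1) = N.dest (Q t) (some (E t (Q t)).2) ∧
      b (t + 1) = (E t (Q t)).1) ∨
    (Q t ≠ P t ∧ (E t (Q t)).1 ≤ b t ∧ b (t + 1) = b t)
  no_cross : ∀ t, s ≤ t → P (t + 1) = Q t → Q (t + 1) = P t → P t = Q t

theorem Roams.count_mono (h : Roams N P c s₀) {s t : ℕ} (hs : s₀ ≤ s) (hst : s ≤ t) :
    c s ≤ c t := by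
  induction t, hst using Nat.le_induction with
  | base => exact le_rfl
  | succ t hst ih =>
    rcases h.step t (hs.trans hst) with ⟨_, h1⟩ | ⟨_, h1⟩ <;> omega

/-- A property of a node which holds when `P` is there and is preserved holds for all nodes
eventually. -/
theorem Roams.eventually_forall [Finite V] (h : Roams N P c s₀) {p : ℕ → V → Prop} {s : ℕ}
    (hpos : ∀ t, s ≤ t → p t (P t)) (hstep : ∀ t, s ≤ t → ∀ v, p t v → p (t + 1) v) :
    ∃ s', s ≤ s' ∧ ∀ t, s' ≤ t → ∀ v, p t v := by
  obtain ⟨e, he, hv⟩ := h.exists_visit_all s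
  refine ⟨e, he, fun t ht v => ?_⟩
  obtain ⟨a, ha, hae, rfl⟩ := hv v
  have hat : a ≤ t := hae.trans ht
  clear ht
  induction t, hat using Nat.le_induction with
  | base => exact hpos a ha
  | succ t hat ih => exact hstep t (ha.trans hat) _ ih

/-- Arbitrary initial records disappear once `P` has left the nodes. Stamps increase along a genuine
trail: when `P` leaves the node pointed to, it writes the stamp `c t + 1`, above all earlier genuine
ones. -/
theorem Trailing.eventually_genuine [Finite V] (h : Trailing N P Q c b E s₀) :
    ∃ s, s₀ ≤ s ∧ ∀ t, s ≤ t → ∀ v, v = P t ∨ ((E t v).1 ≤ c t ∧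
      (N.dest v (some (E t v).2) = P t ∨
        (E t v).1 < (E t (N.dest v (some (E t v).2))).1)) := by
  refine h.roams.eventually_forall (fun t _ => Or.inl rfl) ?_
  intro t ht v hv
  have hc := h.roams.count_mono ht (Nat.le_succ t)
  by_cases hP : P (t + 1) = P t
  · rw [hP, h.entry_stay t ht hP]
    exact hv.imp_right fun h' => ⟨h'.1.trans hc, h'.2⟩
  · obtain ⟨h1, h2, h3⟩ := h.entry_move t ht hP
    right
    by_cases hvt : v = P t
    · subst hvt
      exact ⟨by omega, Or.inl h3⟩
    · obtain ⟨h4, h5⟩ := hv.resolve_left hvt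
      rw [h.entry_other t ht v hvt]
      refine ⟨by omega, Or.inr ?_⟩
      by_cases hw : N.dest v (some (E t v).2) = P t
      · rw [hw, h2]
        omega
      · rw [h.entry_other t ht _ hw]
        exact h5.resolve_left hw

theorem Trailing.eventually_fresh [Finite V] (h : Trailing N P Q c b E s₀) (M : ℕ) :
    ∃ s, s₀ ≤ s ∧ ∀ t, s ≤ t → M ≤ c t ∧ ∀ v, v = P t ∨ M < (E t v).1 := by
  obtain ⟨s, hs, hcs⟩ := h.roams.exists_count_eq le_rfl (le_max_left (c s₀) M)
  have hc : ∀ t, s ≤ t → M ≤ c t := fun t ht =>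
    (le_max_right (c s₀) M).trans (hcs ▸ h.roams.count_mono hs ht)
  obtain ⟨s', hs', h'⟩ := h.roams.eventually_forall (p := fun t v => v = P t ∨ M < (E t v).1)
    (s := s) (fun t _ => Or.inl rfl) (by
      intro t ht v hv
      have ht' := hs.trans ht
      by_cases hP : P (t + 1) = P t
      · rwa [hP, h.entry_stay t ht' hP]
      · right
        by_cases hvt : v = P t
        · subst hvt
          rw [(h.entry_move t ht' hP).2.1]
          exact Nat.lt_succ_of_le (hc t ht)
        · rw [h.entry_other t ht' v hvt]
          exact hv.resolve_left hvt)
  exact ⟨s', hs.trans hs', fun t ht => ⟨hc t (hs'.trans ht), h' t ht⟩⟩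

/-- The point is to rule out the last case of `follow`, in which `Q` sees no valid record of `P` and
may go anywhere. -/
theorem Trailing.exists_pursuit [Finite V] (h : Trailing N P Q c b E s₀) :
    ∃ s, Pursuit P Q (fun t v => N.dest v (some (E t v).2)) s := by
  obtain ⟨s₁, hs₁, hgen⟩ := h.eventually_genuine
  obtain ⟨s₂, hs₂, hfresh⟩ := h.eventually_fresh (b s₁)
  have hnext : ∀ t, s₁ ≤ t → ∀ x v, x ≤ c t → (v = P t ∨ x < (E t v).1) →
      (v = P (t + 1) ∨ x < (E (t + 1) v).1) := by
    intro t ht x v hx hv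
    have ht' := hs₁.trans ht
    by_cases hP : P (t + 1) = P t
    · rwa [hP, h.entry_stay t ht' hP]
    · right
      by_cases hvt : v = P t
      · rw [hvt, (h.entry_move t ht' hP).2.1]
        exact Nat.lt_succ_of_le hx
      · rw [h.entry_other t ht' v hvt]
        exact hv.resolve_left hvt
  -- Either `Q` has a valid sign where it is, as genuine stamps increase along the trail, or its
  -- bound is unchanged since `s₁`; the latter stops mattering at `s₂`, when all stamps away from
  -- `P` exceed that value.
  have hinv : ∀ t, s₁ ≤ t →
      (b t ≤ c t ∧ (Q t = P t ∨ b t < (E t (Q t)).1)) ∨ b t = b s₁ := by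
    intro t ht
    induction t, ht using Nat.le_induction with
    | base => exact Or.inr rfl
    | succ t ht ih =>
      have hc := h.roams.count_mono (hs₁.trans ht) (Nat.le_succ t)
      rcases h.follow t (hs₁.trans ht) with ⟨h1, h2⟩ | ⟨h1, _, h3, h4⟩ | ⟨h1, h2, h3⟩
      · rw [h1, h2]
        exact ih.imp_left fun h' => ⟨h'.1.trans hc, hnext t ht _ _ h'.1 h'.2⟩
      · left
        obtain ⟨h5, h6⟩ := (hgen t ht (Q t)).resolve_left h1
        rw [h4, h3]
        exact ⟨h5.trans hc, hnext t ht _ _ h5 h6⟩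
      · rw [h3]
        refine ih.imp_left fun h' => absurd (h'.2.resolve_left h1) (by omega)
  refine ⟨max s₁ s₂, ⟨?_, ?_, ?_, ?_⟩⟩
  · intro t ht v hv
    simp only [h.entry_other t (by omega) v hv]
  · intro t ht hP
    exact (h.entry_move t (by omega) hP).2.2
  · intro t ht
    rcases h.follow t (by omega) with ⟨h1, _⟩ | ⟨_, _, h1, _⟩ | ⟨h1, h2, _⟩
    · exact Or.inl h1
    · exact Or.inr h1
    · exfalso
      rcases hinv t (by omega) with ⟨_, h4⟩ | h4
      · exact absurd (h4.resolve_left h1) (by omega)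
      · exact absurd (((hfresh t (by omega)).2 (Q t)).resolve_left h1) (by omega)
  · intro t ht
    exact h.no_cross t (by omega)

theorem Trailing.exists_meet [Finite V] (h : Trailing N P Q c b E s₀) (t : ℕ) :
    ∃ t', t ≤ t' ∧ P t' = Q t' := by
  have : Nonempty V := ⟨P 0⟩
  obtain ⟨T, hT⟩ := N.exists_spans
  obtain ⟨s, hs⟩ := h.exists_pursuit
  exact hs.exists_meet (fun n t => h.roams.exists_sweeps hT n t) t

end Trail

/-! ### The trail-following algorithm -/

section Algorithm

/-- An agent with a smaller identifier `r` is present, or it has left a record at the node whose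
time stamp exceeds all time stamps of `r` followed so far. -/
def IsLeader (id : ℕ) (bound : ℕ →₀ ℕ) (board : ℕ →₀ ℕ × ℕ)
    (others : Finset (ℕ × ℕ × (ℕ →₀ ℕ))) (r : ℕ) : Prop :=
  r < id ∧ ((∃ s, (r, s) ∈ others) ∨ bound r < (board r).1)

open Classical in
/-- The transition function of `trailAlgorithm`. -/
noncomputable def trailAct (id : ℕ) (state : ℕ × (ℕ →₀ ℕ)) (ports : Finset ℕ)
    (board : ℕ →₀ ℕ × ℕ) (others : Finset (ℕ × ℕ × (ℕ →₀ ℕ))) :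
    (ℕ × (ℕ →₀ ℕ)) × (ℕ →₀ ℕ × ℕ) × Option ℕ :=
  if h : ∃ r, IsLeader id state.2 board others r then
    if ∃ s, (Nat.find h, s) ∈ others then (state, board, none)
    else ((state.1, state.2.update (Nat.find h) (board (Nat.find h)).1), board,
      some (board (Nat.find h)).2)
  else ((state.1 + 1, state.2),
    if universalWord state.1 ∈ ports then board.update id (state.1 + 1, universalWord state.1)
    else board,
    some (universalWord state.1))

open Classical in
theorem trailAct_cases (id : ℕ) (state : ℕ × (ℕ →₀ ℕ)) (ports : Finset ℕ)
    (board : ℕ →₀ ℕ × ℕ) (others : Finset (ℕ × ℕ × (ℕ →₀ ℕ))) :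
    ((∀ r, ¬ IsLeader id state.2 board others r) ∧
      (trailAct id state ports board others).2.2 = some (universalWord state.1) ∧
      (trailAct id state ports board others).1 = (state.1 + 1, state.2) ∧
      ∀ r, (trailAct id state ports board others).2.1 r =
        if r = id ∧ universalWord state.1 ∈ ports then (state.1 + 1, universalWord state.1)
        else board r) ∨
    ∃ r, IsLeader id state.2 board others r ∧ (∀ r' < r, ¬ IsLeader id state.2 board others r') ∧
      (trailAct id state ports board others).1.1 = state.1 ∧
      (trailAct id state ports board others).2.1 = board ∧
      (((∃ s, (r, s) ∈ others) ∧ (trailAct id state ports board others).2.2 = none ∧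
        ∀ r', (trailAct id state ports board others).1.2 r' = state.2 r') ∨
      ((¬ ∃ s, (r, s) ∈ others) ∧
        (trailAct id state ports board others).2.2 = some (board r).2 ∧
        ∀ r', (trailAct id state ports board others).1.2 r' =
          if r' = r then (board r).1 else state.2 r')) := by
  by_cases hex : ∃ r, IsLeader id state.2 board others r
  · refine Or.inr ⟨Nat.find hex, Nat.find_spec hex, fun r' hr' => Nat.find_min hex hr', ?_⟩
    by_cases hin : ∃ s, (Nat.find hex, s) ∈ others
    · rw [trailAct, dif_pos hex, if_pos hin]
      exact ⟨rfl, rfl, Or.inl ⟨hin, rfl, fun _ => rfl⟩⟩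
    · rw [trailAct, dif_pos hex, if_neg hin]
      exact ⟨rfl, rfl, Or.inr ⟨hin, rfl, fun r' => Finsupp.update_apply ..⟩⟩
  · left
    rw [trailAct, dif_neg hex]
    refine ⟨not_exists.1 hex, rfl, rfl, fun r => ?_⟩
    by_cases hp : universalWord state.1 ∈ ports
    · simp only [hp, if_true, and_true]
      exact Finsupp.update_apply ..
    · simp only [hp, if_false, and_false]

/-- The state of an agent consists of the number of letters of the universal word it has used, and
of the last time stamps it has followed, for all identifiers. A whiteboard holds, for every
identifier, a time stamp and a link label. An agent follows the trail of the smallest identifier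
below its own of which it sees a valid sign, waits if that agent is present, and roams along the
universal word if there is no such sign. -/
noncomputable def trailAlgorithm : Algorithm where
  State := ℕ × (ℕ →₀ ℕ)
  Board := ℕ →₀ ℕ × ℕ
  state_nonempty := inferInstance
  board_nonempty := inferInstance
  state_countable := inferInstance
  board_countable := inferInstance
  act id state ports _ board others := trailAct id state ports board others

variable {k : ℕ} {V : Type}

/-- The number of letters of the universal word which an agent has used. -/
def Config.count (c : Config trailAlgorithm k V) (a : Fin k) : ℕ :=
  @Prod.fst ℕ (ℕ →₀ ℕ) (c.state a)

/-- The last time stamp of the identifier `r` which an agent has followed. -/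
def Config.bound (c : Config trailAlgorithm k V) (a : Fin k) (r : ℕ) : ℕ :=
  @Prod.snd ℕ (ℕ →₀ ℕ) (c.state a) r

/-- The record of the identifier `r` on the whiteboard of a node. -/
def Config.entry (c : Config trailAlgorithm k V) (v : V) (r : ℕ) : ℕ × ℕ :=
  DFunLike.coe (F := ℕ →₀ ℕ × ℕ) (c.board v) r

/-- The agent `a` sees a valid sign of the smaller identifier `r`. -/
def Config.Sees (c : Config trailAlgorithm k V) (ids : Fin k ↪ ℕ) (a : Fin k) (r : ℕ) : Prop :=
  r < ids a ∧ ((∃ b, c.pos b = c.pos a ∧ ids b = r) ∨ c.bound a r < (c.entry (c.pos a) r).1)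

theorem Config.exists_mem_others {c : Config trailAlgorithm k V} {ids : Fin k ↪ ℕ} {a : Fin k}
    {r : ℕ} (hr : r < ids a) :
    (∃ s, (r, s) ∈ c.others ids a) ↔ ∃ b, c.pos b = c.pos a ∧ ids b = r := by
  simp only [Config.others, Set.Finite.mem_toFinset, Set.mem_image, Set.mem_ofPred_eq]
  constructor
  · rintro ⟨s, b, ⟨_, h1⟩, h2⟩
    exact ⟨b, h1, (Prod.ext_iff.1 h2).1⟩
  · rintro ⟨b, h1, rfl⟩
    refine ⟨_, b, ⟨?_, h1⟩, rfl⟩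
    rintro rfl
    exact lt_irrefl _ hr

variable [Finite V] {N : Network V} {ids : Fin k ↪ ℕ} {S : Set (Fin k)}
  {c c' : Config trailAlgorithm k V}

open Classical in
theorem Step.trail_cases (h : Step N ids S c c') {a : Fin k} (ha : a ∈ S) :
    ((∀ r, ¬ c.Sees ids a r) ∧
      c'.pos a = N.dest (c.pos a) (some (universalWord (c.count a))) ∧
      c'.count a = c.count a + 1 ∧ (∀ r, c'.bound a r = c.bound a r) ∧
      ∀ r, c'.entry (c.pos a) r =
        if r = ids a ∧ universalWord (c.count a) ∈ N.ports (c.pos a) then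
          (c.count a + 1, universalWord (c.count a)) else c.entry (c.pos a) r) ∨
    ∃ r, c.Sees ids a r ∧ (∀ r' < r, ¬ c.Sees ids a r') ∧ c'.count a = c.count a ∧
      (∀ r', c'.entry (c.pos a) r' = c.entry (c.pos a) r') ∧
      (((∃ b, c.pos b = c.pos a ∧ ids b = r) ∧ c'.pos a = c.pos a ∧
        ∀ r', c'.bound a r' = c.bound a r') ∨
      ((¬ ∃ b, c.pos b = c.pos a ∧ ids b = r) ∧
        c'.pos a = N.dest (c.pos a) (some (c.entry (c.pos a) r).2) ∧
        ∀ r', c'.bound a r' = if r' = r then (c.entry (c.pos a) r).1 else c.bound a r')) := by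
  have hmem : ∀ r < ids a, (∃ s, (r, s) ∈ c.others ids a) ↔ ∃ b, c.pos b = c.pos a ∧ ids b = r :=
    fun r hr => Config.exists_mem_others hr
  have hsees : ∀ r, IsLeader (ids a) (@Prod.snd ℕ (ℕ →₀ ℕ) (c.state a)) (c.board (c.pos a))
      (c.others ids a) r ↔ c.Sees ids a r :=
    fun r => and_congr_right fun hr => or_congr_left (hmem r hr)
  have hpos : c'.pos a = N.dest (c.pos a) (trailAct (ids a) (c.state a) (N.ports (c.pos a))
    (c.board (c.pos a)) (c.others ids a)).2.2 := h.pos_active a ha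
  have hcount : c'.count a = (trailAct (ids a) (c.state a) (N.ports (c.pos a))
      (c.board (c.pos a)) (c.others ids a)).1.1 :=
    congrArg (@Prod.fst ℕ (ℕ →₀ ℕ)) (h.state_active a ha)
  have hbound : ∀ r, c'.bound a r = (trailAct (ids a) (c.state a) (N.ports (c.pos a))
      (c.board (c.pos a)) (c.others ids a)).1.2 r := fun r =>
    congrArg (fun s : ℕ × (ℕ →₀ ℕ) => s.2 r) (h.state_active a ha)
  have hentry : ∀ r, c'.entry (c.pos a) r = (trailAct (ids a) (c.state a) (N.ports (c.pos a))
      (c.board (c.pos a)) (c.others ids a)).2.1 r := fun r =>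
    congrArg (fun f : ℕ →₀ ℕ × ℕ => f r) (h.board_active a ha)
  rcases trailAct_cases (ids a) (c.state a) (N.ports (c.pos a)) (c.board (c.pos a))
    (c.others ids a) with ⟨h1, h2, h3, h4⟩ | ⟨r, h1, h2, h3, h4, h5⟩
  · refine Or.inl ⟨fun r => (hsees r).not.1 (h1 r), ?_, ?_, fun r => ?_, fun r => ?_⟩
    · rw [hpos, h2]
      rfl
    · rw [hcount, h3]
      rfl
    · rw [hbound, h3]
      rfl
    · rw [hentry, h4]
      rfl
  · refine Or.inr ⟨r, (hsees r).1 h1, fun r' hr' => (hsees r').not.1 (h2 r' hr'),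
      hcount.trans h3, fun r' => ?_, ?_⟩
    · rw [hentry, h4]
      rfl
    · rcases h5 with ⟨h6, h7, h8⟩ | ⟨h6, h7, h8⟩
      · refine Or.inl ⟨(hmem r h1.1).1 h6, ?_, fun r' => (hbound r').trans (h8 r')⟩
        rw [hpos, h7, N.dest_none]
      · refine Or.inr ⟨(hmem r h1.1).not.1 h6, ?_, fun r' => (hbound r').trans (h8 r')⟩
        rw [hpos, h7]
        rfl

theorem Step.bound_le (h : Step N ids S c c') (a : Fin k) (r : ℕ) :
    c.bound a r ≤ c'.bound a r := by
  by_cases ha : a ∈ S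
  · rcases h.trail_cases ha with ⟨_, _, _, h1, _⟩ | ⟨r', h1, _, _, _, ⟨_, _, h2⟩ | ⟨h2, _, h3⟩⟩
    · exact (h1 r).ge
    · exact (h2 r).ge
    · rw [h3]
      split_ifs with hr
      · subst hr
        exact (h1.2.resolve_left h2).le
      · exact le_rfl
  · rw [Config.bound, Config.bound, h.state_idle a ha]

/-- Agents write only under their own identifier, so records of an identifier that no agent bears
never change. -/
theorem Step.entry_eq (h : Step N ids S c c') {v : V} {r : ℕ}
    (hr : ∀ a ∈ S, c.pos a = v → ids a ≠ r) : c'.entry v r = c.entry v r := by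
  by_cases hv : ∃ a ∈ S, c.pos a = v
  · obtain ⟨a, ha, rfl⟩ := hv
    rcases h.trail_cases ha with ⟨_, _, _, _, h1⟩ | ⟨_, _, _, _, h1, _⟩
    · rw [h1, if_neg]
      exact fun h2 => hr a ha rfl h2.1.symm
    · exact h1 r
  · push Not at hv
    rw [Config.entry, Config.entry, h.board_idle v hv]

/-- A bounded monotone sequence of natural numbers is eventually constant. -/
theorem exists_eventually_const {f : ℕ → ℕ} (hf : Monotone f) {M : ℕ} (hM : ∀ n, f n ≤ M) :
    ∃ n, ∀ m, n ≤ m → f m = f n := by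
  refine ⟨Function.argmin (fun n => M - f n), fun m hm => le_antisymm ?_ (hf hm)⟩
  have h1 := Function.argmin_le (fun n => M - f n) m
  have h2 := hM m
  have h3 := hM (Function.argmin (fun n => M - f n))
  omega

/-- Identifiers below the minimum belong to nobody, so their records are finitely many and constant.
An active agent seeing one follows the least, which strictly raises its bound; this can happen only
finitely often. -/
theorem Execution.eventually_not_sees (e : Execution trailAlgorithm N ids) {p : Fin k}
    (hp : ∀ b, ids p ≤ ids b) :
    ∃ s, ∀ t, s ≤ t → ∀ a ∈ e.active t, ∀ r < ids p, ¬ (e.conf t).Sees ids a r := by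
  have hentry : ∀ r < ids p, ∀ v t, (e.conf t).entry v r = (e.conf 0).entry v r := by
    intro r hr v t
    induction t with
    | zero => rfl
    | succ t ih =>
      rw [← ih]
      exact (e.step t).entry_eq fun a _ _ => (hr.trans_le (hp a)).ne'
  obtain ⟨M, hM⟩ := (Set.finite_range fun x : V × Fin (ids p) =>
    ((e.conf 0).entry x.1 x.2).1).bddAbove
  -- Truncation at `M`, the largest phantom stamp, makes the monotone bounds bounded and still
  -- detects each following step, which lifts a bound to a stamp of at most `M`.
  have hconst : ∀ x : Fin k × Fin (ids p), ∃ s, ∀ t, s ≤ t →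
      min ((e.conf t).bound x.1 x.2) M = min ((e.conf s).bound x.1 x.2) M := by
    intro x
    refine exists_eventually_const (f := fun t => min ((e.conf t).bound x.1 x.2) M)
      (monotone_nat_of_le_succ fun t => ?_) (fun t => min_le_right _ M)
    exact min_le_min_right _ ((e.step t).bound_le _ _)
  choose s hs using hconst
  obtain ⟨s', hs'⟩ := (Set.finite_range s).bddAbove
  refine ⟨s', fun t ht a ha r hr hsees => ?_⟩
  have habsent : ∀ r' < ids p, ¬ ∃ b, (e.conf t).pos b = (e.conf t).pos a ∧ ids b = r' := by
    rintro _ hr' ⟨b, _, rfl⟩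
    exact absurd (hp b) (not_le.2 hr')
  rcases (e.step t).trail_cases ha with ⟨h1, _⟩ | ⟨r', h1, h2, _, _, ⟨h3, _⟩ | ⟨h3, _, h4⟩⟩
  · exact h1 r hsees
  · exact habsent r' ((not_lt.1 fun h => h2 r h hsees).trans_lt hr) h3
  · have hr' : r' < ids p := (not_lt.1 fun h => h2 r h hsees).trans_lt hr
    have h5 := h1.2.resolve_left h3
    have h6 := h4 r'
    rw [if_pos rfl] at h6
    have h7 := hM (Set.mem_range_self ((e.conf t).pos a, (⟨r', hr'⟩ : Fin (ids p))))
    have h8 := hs' (Set.mem_range_self (a, (⟨r', hr'⟩ : Fin (ids p))))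
    have h9 := (hs (a, ⟨r', hr'⟩) t (h8.trans ht)).trans
      (hs (a, ⟨r', hr'⟩) (t + 1) (h8.trans (ht.trans (Nat.le_succ t)))).symm
    simp only at h7 h9
    rw [← hentry r' hr' _ t] at h7
    rw [h6] at h9
    omega

theorem Execution.exists_trailing (e : Execution trailAlgorithm N ids) {p q : Fin k}
    (hp : ∀ b, ids p ≤ ids b) (hpq : q ≠ p) :
    ∃ s, Trailing N (fun t => (e.conf t).pos p) (fun t => (e.conf t).pos q)
      (fun t => (e.conf t).count p) (fun t => (e.conf t).bound q (ids p))
      (fun t v => (e.conf t).entry v (ids p)) s := by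
  obtain ⟨s, hs⟩ := e.eventually_not_sees hp
  have hlt : ids p < ids q := lt_of_le_of_ne (hp q) fun h => hpq (ids.injective h).symm
  have hlead : ∀ t, s ≤ t → p ∈ e.active t →
      (e.conf (t + 1)).pos p =
        N.dest ((e.conf t).pos p) (some (universalWord ((e.conf t).count p))) ∧
      (e.conf (t + 1)).count p = (e.conf t).count p + 1 ∧
      (e.conf (t + 1)).entry ((e.conf t).pos p) (ids p) =
        if universalWord ((e.conf t).count p) ∈ N.ports ((e.conf t).pos p) then
          ((e.conf t).count p + 1, universalWord ((e.conf t).count p))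
        else (e.conf t).entry ((e.conf t).pos p) (ids p) := by
    intro t ht hpt
    rcases (e.step t).trail_cases hpt with ⟨_, h1, h2, _, h3⟩ | ⟨r, h1, _⟩
    · refine ⟨h1, h2, ?_⟩
      rw [h3]
      simp only [true_and]
    · exact absurd h1 (hs t ht p hpt r h1.1)
  have hidle : ∀ t, p ∉ e.active t → (e.conf (t + 1)).pos p = (e.conf t).pos p ∧
      (e.conf (t + 1)).count p = (e.conf t).count p ∧
      ∀ v, (e.conf (t + 1)).entry v (ids p) = (e.conf t).entry v (ids p) := by
    intro t hpt
    refine ⟨(e.step t).pos_idle p hpt, ?_, fun v => (e.step t).entry_eq ?_⟩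
    · rw [Config.count, Config.count, (e.step t).state_idle p hpt]
    · rintro a ha _ h
      exact hpt (ids.injective h ▸ ha)
  have hother : ∀ t v, v ≠ (e.conf t).pos p →
      (e.conf (t + 1)).entry v (ids p) = (e.conf t).entry v (ids p) := by
    intro t v hv
    refine (e.step t).entry_eq ?_
    rintro a _ rfl h
    exact hv (by rw [ids.injective h])
  refine ⟨s, ⟨⟨?_, ?_⟩, fun t _ v hv => hother t v hv, ?_, ?_, ?_, ?_⟩⟩
  · intro t ht
    by_cases hpt : p ∈ e.active t
    · exact Or.inr ⟨(hlead t ht hpt).1, (hlead t ht hpt).2.1⟩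
    · exact Or.inl ⟨(hidle t hpt).1, (hidle t hpt).2.1⟩
  · intro t
    obtain ⟨t', ht', hpt⟩ := e.fair p (max t s)
    exact ⟨t', by omega, (hlead t' (by omega) hpt).2.1⟩
  · intro t ht hP
    funext v
    by_cases hpt : p ∈ e.active t
    · by_cases hv : v = (e.conf t).pos p
      · obtain ⟨h1, _, h2⟩ := hlead t ht hpt
        subst hv
        -- A letter that is not a port leaves `P` in place; it is counted but not recorded.
        refine h2.trans (if_neg ?_)
        rw [← N.dest_eq_self_iff, ← h1]
        exact hP
      · exact hother t v hv
    · exact (hidle t hpt).2.2 v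
  · intro t ht hP
    by_cases hpt : p ∈ e.active t
    · obtain ⟨h1, h2, h3⟩ := hlead t ht hpt
      rw [if_pos] at h3
      · simp only [h3, true_and]
        exact ⟨h2, h1.symm⟩
      · by_contra h4
        rw [← N.dest_eq_self_iff, ← h1] at h4
        exact hP h4
    · exact absurd (hidle t hpt).1 hP
  · intro t ht
    by_cases hqt : q ∈ e.active t
    · by_cases hsee : (e.conf t).Sees ids q (ids p)
      · rcases (e.step t).trail_cases hqt with ⟨h1, _⟩ | ⟨r, h1, h2, _, _, h3⟩
        · exact absurd hsee (h1 _)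
        · obtain rfl : r = ids p := le_antisymm (not_lt.1 fun h => h2 _ h hsee)
            (not_lt.1 fun h => hs t ht q hqt r h h1)
          rcases h3 with ⟨_, h4, h5⟩ | ⟨h3, h4, h5⟩
          · exact Or.inl ⟨h4, h5 _⟩
          · exact Or.inr (Or.inl ⟨fun h => h3 ⟨p, h.symm, rfl⟩, h1.2.resolve_left h3, h4,
              (h5 _).trans (if_pos rfl)⟩)
      · refine Or.inr (Or.inr ⟨fun h => hsee ⟨hlt, Or.inl ⟨p, h.symm, rfl⟩⟩,
          not_lt.1 fun h => hsee ⟨hlt, Or.inr h⟩, ?_⟩)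
        rcases (e.step t).trail_cases hqt with
          ⟨_, _, _, h1, _⟩ | ⟨r, h1, _, _, _, ⟨_, _, h2⟩ | ⟨_, _, h2⟩⟩
        · exact h1 _
        · exact h2 _
        · refine (h2 _).trans (if_neg ?_)
          rintro rfl
          exact hsee h1
    · left
      refine ⟨(e.step t).pos_idle q hqt, ?_⟩
      simp only [Config.bound, (e.step t).state_idle q hqt]
  · intro t _ h1 h2
    by_cases hpt : p ∈ e.active t
    · by_cases hqt : q ∈ e.active t
      · refine absurd ((e.step t).halfDuplex p hpt q hqt ?_ ?_) hpq.symm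
        · exact ((e.step t).pos_active p hpt).symm.trans h1
        · exact ((e.step t).pos_active q hqt).symm.trans h2
      · exact h2.symm.trans ((e.step t).pos_idle q hqt)
    · exact ((e.step t).pos_idle p hpt).symm.trans h1

end Algorithm

theorem trailAlgorithm_meetsMinInfinitelyOften : trailAlgorithm.MeetsMinInfinitelyOften := by
  intro k V _ N ids e p hp q T
  by_cases hpq : q = p
  · exact ⟨T, le_rfl, by rw [hpq]⟩
  · obtain ⟨s, hs⟩ := e.exists_trailing hp hpq
    obtain ⟨t, ht, h⟩ := hs.exists_meet T
    exact ⟨t, ht, h.symm⟩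

theorem Execution.know_mono {A : Algorithm} {k : ℕ} {V : Type} [Finite V] {N : Network V}
    {ids : Fin k ↪ ℕ} (e : Execution A N ids) {s t : ℕ} (h : s ≤ t) (a : Fin k) :
    (e.conf s).know a ⊆ (e.conf t).know a := by
  induction t, h using Nat.le_induction with
  | base => exact subset_rfl
  | succ t _ ih =>
    intro g hg
    rw [(e.step t).exchange]
    exact ⟨a, rfl, ih hg⟩

/-- Two rounds of meetings suffice: in the first the minimum agent collects all gossip, in the
second it hands it out. -/
theorem Algorithm.MeetsMinInfinitelyOften.solvesGossip {A : Algorithm}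
    (hA : A.MeetsMinInfinitelyOften) : A.SolvesGossip := by
  intro k V _ N ids e
  rcases k.eq_zero_or_pos with rfl | hk
  · exact ⟨0, fun _ _ a => a.elim0⟩
  have : Nonempty (Fin k) := ⟨⟨0, hk⟩⟩
  obtain ⟨p, hp⟩ : ∃ p, ∀ b, ids p ≤ ids b := ⟨_, fun b => Function.argmin_le ids b⟩
  have meet : ∀ T a, ∃ t, T ≤ t ∧ (e.conf t).pos a = (e.conf t).pos p :=
    fun T a => hA k V N ids e p hp a T
  choose f hf hmeet using meet
  -- The `+ 1` is there because gossip exchanged at a meeting appears in the next configuration.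
  obtain ⟨T₁, hT₁⟩ := (Set.finite_range fun a => f 0 a + 1).bddAbove
  have hknow : ∀ b, b ∈ (e.conf T₁).know p := by
    intro b
    refine e.know_mono (hT₁ (Set.mem_range_self b)) p ?_
    rw [(e.step (f 0 b)).exchange]
    exact ⟨b, hmeet 0 b, e.know_mono (Nat.zero_le _) b (e.init b)⟩
  obtain ⟨T₂, hT₂⟩ := (Set.finite_range fun a => f T₁ a + 1).bddAbove
  refine ⟨T₂, fun t ht a b => ?_⟩
  refine e.know_mono ((hT₂ (Set.mem_range_self a)).trans ht) a ?_
  rw [(e.step (f T₁ a)).exchange]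
  exact ⟨p, (hmeet T₁ a).symm, e.know_mono (hf T₁ a) p (hknow b)⟩

end MobileAgents

theorem mainTheorem7 :
    (∀ k : ℕ, 1 ≤ k → MobileAgents.IsGossipQuiescenceNumber k 0) ∧
      ∃ A : MobileAgents.Algorithm, A.SolvesGossip ∧ A.MeetsMinInfinitelyOften := by
  have hmeet := MobileAgents.trailAlgorithm_meetsMinInfinitelyOften
  refine ⟨fun k hk => ⟨?_, ?_⟩, _, hmeet.solvesGossip, hmeet⟩
  · refine Or.inr ⟨0, rfl, _, hmeet.solvesGossip, ?_⟩
    intro V _ N ids e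
    exact ⟨0, ∅, Nat.zero_le _, by simp⟩
  · rintro z (rfl | ⟨l, rfl, A, hA, hq⟩)
    · norm_num
    · by_contra hl
      exact hA.not_isQuiescent hk (by omega) hq
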